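/- Let $K$ be an infinite field with $\operatorname{char} K\neq 2$, and let $p(x_1,\dots,x_m)=\sum_{\sigma\in S_m}c_\sigma x_{\sigma(1)}\cdots x_{\sigma(m)}$ $(c_\sigma\in K)$ be a multilinear noncommutative polynomial which is neither a polynomial identity of $M_4(K)$ (i.e. not all of its values on $M_4(K)$ are $0$) nor a central polynomial of $M_4(K)$ (i.e. not all of its values on $M_4(K)$ are scalar matrices). Let $\operatorname{Im} p=\{p(a_1,\dots,a_m): a_1,\dots,a_m\in M_4(K)\}$, and let $\dim\operatorname{Im} p$ denote the dimension of its Zariski closure in the affine space of $4\times 4$ matrices, i.e. the Krull dimension of the quotient of the polynomial ring over $K$ in the $16$ matrix entries by the ideal of polynomials vanishing on $\operatorname{Im} p$. Then $\dim\operatorname{Im} p\ge 14$. Moreover, if $\dim\operatorname{Im} p=14$, then both of the following hold. 1. For any matrix units $a_1,\dots,a_m\in M_4(K)$ (each $a_k$ is some $e_{ij}$, where $i=j$ is allowed), if $p(a_1,\dots,a_m)$ is diagonal, then its eigenvalues, counted with multiplicity, are $(c,c,-c,-c)$ for some $c\in K$. 2. Every value $p(a_1,\dots,a_m)$ with $a_1,\dots,a_m\in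 M_4(K)$ has eigenvalues, counted with multiplicity, $(\lambda_1,\lambda_2,-\lambda_1,-\lambda_2)$ for some $\lambda_1,\lambda_2$ in an algebraic closure of $K$. -/

import Mathlib

/-- The value `p(a₁, …, aₘ)` of a noncommutative polynomial `p ∈ K⟨x₁, …, xₘ⟩` in a `K`-algebra. -/
def ncEval {K : Type*} [Field K] {m : ℕ} {R : Type*} [Ring R] [Algebra K R]
    (p : FreeAlgebra K (Fin m)) (a : Fin m → R) : R :=
  FreeAlgebra.lift K a p

/-- `p` is multilinear: `p = ∑_{σ ∈ Sₘ} c_σ x_{σ(1)} ⋯ x_{σ(m)}` with constants `c_σ ∈ K`. -/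
def IsMultilinearPoly {K : Type*} [Field K] {m : ℕ} (p : FreeAlgebra K (Fin m)) : Prop :=
  ∃ c : Equiv.Perm (Fin m) → K,
    p = ∑ σ : Equiv.Perm (Fin m), c σ • (List.ofFn fun i => FreeAlgebra.ι K (σ i)).prod

/-- `p` is a polynomial identity of the `K`-algebra `R`. -/
def IsPIOf {K : Type*} [Field K] {m : ℕ} (p : FreeAlgebra K (Fin m))
    (R : Type*) [Ring R] [Algebra K R] : Prop :=
  ∀ a : Fin m → R, ncEval p a = 0

/-- `p` is a central polynomial of the `K`-algebra `R`: all its values lie in the centre of `R`,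
and it is not a polynomial identity of `R`. -/
def IsCentralPolyOf {K : Type*} [Field K] {m : ℕ} (p : FreeAlgebra K (Fin m))
    (R : Type*) [Ring R] [Algebra K R] : Prop :=
  (∀ a : Fin m → R, ncEval p a ∈ Subalgebra.center K R) ∧ ¬ IsPIOf p R

/-- The image (set of values) of `p` in the `K`-algebra `R`. -/
def imageOf {K : Type*} [Field K] {m : ℕ} (p : FreeAlgebra K (Fin m))
    (R : Type*) [Ring R] [Algebra K R] : Set R :=
  {r | ∃ a : Fin m → R, ncEval p a = r}

/-- The ideal of all polynomials in the `n²` matrix entries that vanish on a set `S ⊆ Mₙ(K)`. -/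
noncomputable def matrixVanishingIdeal {K : Type*} [Field K] {n : ℕ}
    (S : Set (Matrix (Fin n) (Fin n) K)) : Ideal (MvPolynomial (Fin n × Fin n) K) :=
  MvPolynomial.vanishingIdeal K ((fun M (ij : Fin n × Fin n) => M ij.1 ij.2) '' S)

/-- The dimension of a set `S ⊆ Mₙ(K)`: the dimension of its Zariski closure in the affine space of
`n × n` matrices, i.e. the Krull dimension of the coordinate ring of that closure. -/
noncomputable def zariskiDim {K : Type*} [Field K] {n : ℕ}
    (S : Set (Matrix (Fin n) (Fin n) K)) : WithBot ℕ∞ :=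
  ringKrullDim (MvPolynomial (Fin n × Fin n) K ⧸ matrixVanishingIdeal S)

open Matrix

/-! The image is stable under conjugation, so its dimension splits into an orbit part and a spectral
part. If `e₀` is a cyclic vector of the generic value `P`, conjugation moves the twelve entries of
`P e₀, P² e₀, P³ e₀` freely without changing the characteristic coefficients. Hence the dimension is
at least 12 plus the transcendence degree of these coefficients
(`IsMultilinearPoly.add_card_le_zariskiDim`). Cyclicity is witnessed by a value supported on a
4-cycle, found by replacing matrix units with generic combinations of their translates by `ZMod 4`
(`IsMultilinearPoly.exists_cyclic_mem_imageOf`).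

For the spectral part, take a nonscalar diagonal value on matrix units. Its translates by a group of
order 4 acting simply transitively on the indices lie in a multilinear family of diagonal values. If
two members are independent, then two independent members differ in a single slot, so the plane they
span consists of values. A plane of spectra has transcendence degree 2, which gives 14. The Klein
group works unless the value is `(x, x, -x, -x)` up to order; then `ZMod 4` works.

If the dimension is 14, the transcendence degree is exactly 2, so all relations between the
characteristic coefficients on the plane hold for `P`, and every spectrum lies in the plane up to a
permutation. The plane is negated by a permutation of coordinates. For `ZMod 4` this is the half
turn. For the Klein group, the spectrum of fourth roots coming from the 4-cycle value lies in the
extended plane and, with one of its translates, spans it. Thus `e₁` and `e₃` vanish on the plane,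
hence for `P`, and every characteristic polynomial is even. For matrix units, `e₁ = e₃ = 0` on the
translated families of several 4-cycles forces `(c, c, -c, -c)`. -/

/-! ### Krull dimension and algebraic independence -/

theorem ringKrullDim_le_of_isIntegral_of_injective {R S : Type*} [CommRing R] [CommRing S]
    [Algebra R S] [Algebra.IsIntegral R S] (h : Function.Injective (algebraMap R S)) :
    ringKrullDim R ≤ ringKrullDim S := by
  refine iSup_le fun l => ?_
  -- Lying over lifts the first prime of the chain; going up lifts the rest.
  obtain ⟨P, -, hP, hPl⟩ := Ideal.exists_ideal_over_prime_of_isIntegral (S := S)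
    (RelSeries.head l).asIdeal ⊥ (by
      rw [← RingHom.ker_eq_comap_bot, (RingHom.injective_iff_ker_eq_bot _).mp h]; exact bot_le)
  have : P.LiesOver (RelSeries.head l).asIdeal := ⟨hPl.symm⟩
  obtain ⟨L, hL, -⟩ := Ideal.exists_ltSeries_of_hasGoingUp (S := S) l P
  exact hL ▸ Order.LTSeries.length_le_krullDim L

/-- In a finitely generated domain, the number of algebraically independent elements is at most
the Krull dimension. -/
theorem AlgebraicIndependent.card_le_ringKrullDim {K R ι : Type*} [Field K] [CommRing R] [IsDomain R]
    [Algebra K R] [Algebra.FiniteType K R] [Fintype ι] {x : ι → R}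
    (hx : AlgebraicIndependent K x) : (Fintype.card ι : WithBot ℕ∞) ≤ ringKrullDim R := by
  -- Noether normalization: `R` is integral over a polynomial ring in `s` variables, so `s` is its
  -- transcendence degree and a lower bound for its Krull dimension.
  obtain ⟨s, g, hg, hint⟩ := exists_integral_inj_algHom_of_fg K R
  algebraize [g.toRingHom]
  have hfaith : FaithfulSMul (MvPolynomial (Fin s) K) R := (faithfulSMul_iff_algebraMap_injective _ _).mpr hg
  have htower : IsScalarTower K (MvPolynomial (Fin s) K) R :=
    IsScalarTower.of_algebraMap_eq fun r => (g.commutes r).symm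
  have : Algebra.IsIntegral (MvPolynomial (Fin s) K) R := ⟨hint⟩
  have hb := (IsTranscendenceBasis.mvPolynomial (Fin s) K).algebraMap_comp (A := R)
  have h1 := hb.lift_cardinalMk_eq_trdeg
  have h2 := hx.lift_cardinalMk_le_trdeg
  have h3 : Fintype.card ι ≤ s := by
    rw [Cardinal.mk_fin, Cardinal.lift_natCast] at h1
    have h4 : Algebra.trdeg K R = s := by simpa using h1.symm
    rw [h4, Cardinal.mk_fintype] at h2
    simpa using h2
  calc (Fintype.card ι : WithBot ℕ∞) ≤ s := by exact_mod_cast h3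
    _ = ringKrullDim (MvPolynomial (Fin s) K) := by
      rw [MvPolynomial.ringKrullDim_of_isNoetherianRing]; simp
    _ ≤ ringKrullDim R := ringKrullDim_le_of_isIntegral_of_injective hg

/-- If `B` has no three algebraically independent elements and `φ : B → C` keeps two elements
algebraically independent, then `φ` is injective. -/
theorem eq_zero_of_map_eq_zero_of_not_algebraicIndependent {K B C : Type*} [Field K] [CommRing B]
    [IsDomain B] [CommRing C] [Algebra K B] [Algebra K C] (φ : B →ₐ[K] C) {x : Fin 2 → B}
    (hx : AlgebraicIndependent K (φ ∘ x))
    (h3 : ∀ y : Option (Fin 2) → B, ¬ AlgebraicIndependent K y) {b : B} (hb : φ b = 0) : b = 0 := by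
  by_contra hb0
  have hx' : AlgebraicIndependent K x := AlgebraicIndependent.of_comp φ hx
  have h := h3 (fun o => o.elim b x)
  rw [hx'.option_iff_transcendental, Transcendental, not_not] at h
  -- A relation for `b` over `K[x]` with nonzero constant term: since `φ` kills `b`, only this
  -- constant term survives, and its vanishing contradicts the independence of `φ ∘ x`.
  obtain ⟨q, hq0, hq⟩ := h.exists_nonzero_coeff_and_aeval_eq_zero (mem_nonZeroDivisors_of_ne_zero hb0)
  apply hq0
  have h1 : φ (q.coeff 0) = 0 := by
    rw [Polynomial.aeval_eq_sum_range, Finset.sum_range_succ'] at hq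
    have := congrArg φ hq
    rw [map_add, map_sum, map_zero, Finset.sum_eq_zero] at this
    · simpa [Algebra.smul_def] using this
    · intro i _
      simp [Algebra.smul_def, hb]
  obtain ⟨P, hP⟩ : ∃ P : MvPolynomial (Fin 2) K, MvPolynomial.aeval x P = (q.coeff 0 : B) := by
    exact (Algebra.adjoin_range_eq_range_aeval K x).le (q.coeff 0).2
  have hP0 : P = 0 := by
    apply hx
    rw [map_zero, ← h1, ← hP, MvPolynomial.comp_aeval_apply]
    rfl
  ext
  rw [← hP, hP0]; simp

/-! ### Evaluation of noncommutative polynomials -/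

section Evaluation

variable {K : Type*} [Field K] {m : ℕ}

/-- Evaluation commutes with homomorphisms of algebras. -/
theorem map_ncEval {R S : Type*} [Ring R] [Ring S] [Algebra K R] [Algebra K S] (φ : R →ₐ[K] S)
    (p : FreeAlgebra K (Fin m)) (a : Fin m → R) : φ (ncEval p a) = ncEval p fun k => φ (a k) := by
  have : φ.comp (FreeAlgebra.lift K a) = FreeAlgebra.lift K fun k => φ (a k) := by
    ext; simp
  exact DFunLike.congr_fun this p

theorem ncEval_sum_smul_prod {R : Type*} [Ring R] [Algebra K R] (c : Equiv.Perm (Fin m) → K)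
    (a : Fin m → R) :
    ncEval (∑ σ : Equiv.Perm (Fin m), c σ • (List.ofFn fun i => FreeAlgebra.ι K (σ i)).prod) a =
      ∑ σ : Equiv.Perm (Fin m), c σ • (List.ofFn fun i => a (σ i)).prod := by
  simp [ncEval, map_list_prod, List.map_ofFn, Function.comp_def]

/-- The evaluation of a multilinear polynomial on an algebra over a commutative `K`-algebra is a
multilinear map. -/
theorem IsMultilinearPoly.exists_multilinearMap {p : FreeAlgebra K (Fin m)}
    (hp : IsMultilinearPoly p) (L R : Type*) [CommRing L] [Ring R] [Algebra K L] [Algebra L R]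
    [Algebra K R] [IsScalarTower K L R] :
    ∃ f : MultilinearMap L (fun _ : Fin m => R) R, ∀ a, f a = ncEval p a := by
  obtain ⟨c, rfl⟩ := hp
  refine ⟨∑ σ : Equiv.Perm (Fin m), algebraMap K L (c σ) •
    (MultilinearMap.mkPiAlgebraFin L m R).domDomCongr σ, fun a => ?_⟩
  rw [ncEval_sum_smul_prod]
  simp

end Evaluation

/-! ### Gradings of the matrix algebra by weights of the indices -/

section Grading

variable {n Γ L : Type*} [CommRing L] [AddCommGroup Γ]

/-- `M` is homogeneous of degree `d` when the matrix unit at `(i, j)` has degree `w j - w i`. -/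
def Matrix.IsWeightHomogeneous (w : n → Γ) (d : Γ) (M : Matrix n n L) : Prop :=
  ∀ i j, M i j ≠ 0 → w j - w i = d

variable {w : n → Γ}

theorem Matrix.IsWeightHomogeneous.zero (d : Γ) :
    (0 : Matrix n n L).IsWeightHomogeneous w d := fun _ _ h => (h rfl).elim

theorem Matrix.IsWeightHomogeneous.add {d : Γ} {M N : Matrix n n L}
    (hM : M.IsWeightHomogeneous w d) (hN : N.IsWeightHomogeneous w d) :
    (M + N).IsWeightHomogeneous w d := by
  intro i j h
  by_cases h1 : M i j = 0
  · exact hN i j fun h2 => h (by simp [h1, h2])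
  · exact hM i j h1

theorem Matrix.IsWeightHomogeneous.sum {ι : Type*} {s : Finset ι} {d : Γ} {M : ι → Matrix n n L}
    (hM : ∀ i ∈ s, (M i).IsWeightHomogeneous w d) :
    (∑ i ∈ s, M i).IsWeightHomogeneous w d := by
  classical
  induction s using Finset.induction_on with
  | empty => simpa using .zero d
  | insert a s ha ih =>
    rw [Finset.sum_insert ha]
    exact (hM a (by simp)).add (ih fun i hi => hM i (by simp [hi]))

theorem Matrix.IsWeightHomogeneous.smul {R : Type*} [SMulZeroClass R L] {d : Γ}
    {M : Matrix n n L} (hM : M.IsWeightHomogeneous w d) (c : R) :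
    (c • M).IsWeightHomogeneous w d :=
  fun i j h => hM i j fun h0 => h (by simp [h0])

theorem Matrix.IsWeightHomogeneous.mul [Fintype n] {d e : Γ} {M N : Matrix n n L}
    (hM : M.IsWeightHomogeneous w d) (hN : N.IsWeightHomogeneous w e) :
    (M * N).IsWeightHomogeneous w (d + e) := by
  intro i j h
  rw [Matrix.mul_apply] at h
  obtain ⟨k, -, hk⟩ := Finset.exists_ne_zero_of_sum_ne_zero h
  rw [← hM i k (left_ne_zero_of_mul hk), ← hN k j (right_ne_zero_of_mul hk)]
  abel

theorem Matrix.IsWeightHomogeneous.one [DecidableEq n] :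
    (1 : Matrix n n L).IsWeightHomogeneous w 0 := by
  intro i j h
  by_cases hij : i = j
  · simp [hij]
  · simp [hij] at h

theorem Matrix.IsWeightHomogeneous.list_prod [Fintype n] [DecidableEq n] {m : ℕ} {d : Fin m → Γ}
    {M : Fin m → Matrix n n L} (hM : ∀ k, (M k).IsWeightHomogeneous w (d k)) :
    (List.ofFn M).prod.IsWeightHomogeneous w (∑ k, d k) := by
  induction m with
  | zero => simpa using .one
  | succ m ih =>
    rw [List.ofFn_succ, List.prod_cons, Fin.sum_univ_succ]
    exact (hM 0).mul (ih fun k => hM k.succ)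

theorem Matrix.IsWeightHomogeneous.single [DecidableEq n] (i j : n) (c : L) :
    (Matrix.single i j c).IsWeightHomogeneous w (w j - w i) := by
  intro k l h
  by_cases h1 : i = k ∧ j = l
  · rw [h1.1, h1.2]
  · exact (h (Matrix.single_apply_of_ne _ _ _ _ _ h1)).elim

/-- A multilinear polynomial takes homogeneous matrices to a homogeneous matrix. -/
theorem IsMultilinearPoly.isWeightHomogeneous {K : Type*} [Field K] [Algebra K L] [Fintype n]
    [DecidableEq n] {m : ℕ} {p : FreeAlgebra K (Fin m)} (hp : IsMultilinearPoly p) {d : Fin m → Γ}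
    {M : Fin m → Matrix n n L} (hM : ∀ k, (M k).IsWeightHomogeneous w (d k)) :
    (ncEval p M).IsWeightHomogeneous w (∑ k, d k) := by
  obtain ⟨c, rfl⟩ := hp
  rw [ncEval_sum_smul_prod]
  refine .sum fun σ _ => .smul ?_ _
  rw [← Equiv.sum_comp σ d]
  exact .list_prod fun k => hM (σ k)

end Grading

/-! ### Conjugation and the values on matrix units -/

section Conjugation

variable {K : Type*} [Field K] {m : ℕ}

/-- The values of a noncommutative polynomial are stable under conjugation. -/
theorem conj_ncEval {R : Type*} [Ring R] [Algebra K R] {h h' : R} (hh : h * h' = 1) (hh' : h' * h = 1)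
    (p : FreeAlgebra K (Fin m)) (a : Fin m → R) :
    h * ncEval p a * h' = ncEval p fun k => h * a k * h' := by
  let φ : R →ₐ[K] R := AlgHom.ofLinearMap
    ((LinearMap.mulRight K h').comp (LinearMap.mulLeft K h)) (by simp [hh]) (by
      intro x y
      simp only [LinearMap.comp_apply, LinearMap.mulLeft_apply, LinearMap.mulRight_apply]
      calc h * (x * y) * h' = h * x * 1 * y * h' := by noncomm_ring
        _ = _ := by rw [← hh']; noncomm_ring)
  exact map_ncEval φ p a

/-- The values of a multilinear polynomial lie in every subspace that contains the values on
matrix units. -/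
theorem IsMultilinearPoly.mem_of_forall_single_mem {n : Type*} [Fintype n] [DecidableEq n]
    {p : FreeAlgebra K (Fin m)} (hp : IsMultilinearPoly p) (S : Submodule K (Matrix n n K))
    (hS : ∀ i j : Fin m → n, (ncEval p fun k => Matrix.single (i k) (j k) (1 : K)) ∈ S)
    (a : Fin m → Matrix n n K) : ncEval p a ∈ S := by
  obtain ⟨f, hf⟩ := hp.exists_multilinearMap K (Matrix n n K)
  have : S.mkQ.compMultilinearMap f = 0 := by
    refine Module.Basis.ext_multilinear (fun _ => Matrix.stdBasis K n n) fun v => ?_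
    have h1 : ∀ k, Matrix.stdBasis K n n (v k) = Matrix.single (v k).1 (v k).2 1 :=
      fun k => Matrix.stdBasis_eq_single K (v k).1 (v k).2
    simpa [h1, hf] using hS (fun k => (v k).1) fun k => (v k).2
  simpa [hf] using DFunLike.congr_fun this a

theorem Matrix.transvection_conj_apply {n : Type*} [Fintype n] [DecidableEq n] (M : Matrix n n K)
    (i j a b : n) :
    ((1 + Matrix.single i j 1) * M * (1 - Matrix.single i j 1) : Matrix n n K) a b =
      M a b + (if a = i then M j b else 0) - (if b = j then M a i else 0) -
        (if a = i ∧ b = j then M j i else 0) := by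
  have h1 : ∀ N : Matrix n n K, ∀ a b, (Matrix.single i j 1 * N : Matrix n n K) a b = if a = i then N j b else 0 := by
    intro N a b
    split_ifs with h
    · simp [h]
    · exact Matrix.single_mul_apply_of_ne _ _ _ _ _ h _
  have h2 : ∀ N : Matrix n n K, ∀ a b, (N * Matrix.single i j 1 : Matrix n n K) a b = if b = j then N a i else 0 := by
    intro N a b
    split_ifs with h
    · simp [h]
    · exact Matrix.mul_single_apply_of_ne _ _ _ _ _ h _
  rw [mul_sub, mul_one, add_mul, one_mul, add_mul]
  simp only [Matrix.sub_apply, Matrix.add_apply, h1, h2]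
  split_ifs <;> simp_all; ring

theorem Matrix.mem_center_of_apply {n : Type*} [Fintype n] [DecidableEq n] {M : Matrix n n K}
    (h0 : ∀ i j, i ≠ j → M i j = 0) (h1 : ∀ i j, M i i = M j j) :
    M ∈ Subalgebra.center K (Matrix n n K) := by
  rw [Subalgebra.mem_center_iff]
  have : M = Matrix.diagonal fun i => M i i := by
    ext i j
    by_cases h : i = j
    · simp [h]
    · simp [h, h0 i j h]
  intro N
  rw [this]
  ext i j
  simp [Matrix.mul_diagonal, Matrix.diagonal_mul, h1 i j, mul_comm]

theorem Matrix.one_add_single_mul_one_sub_single {n : Type*} [Fintype n] [DecidableEq n] {i j : n}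
    (h : i ≠ j) : ((1 + Matrix.single i j 1) * (1 - Matrix.single i j 1) : Matrix n n K) = 1 ∧
      ((1 - Matrix.single i j 1) * (1 + Matrix.single i j 1) : Matrix n n K) = 1 := by
  have : (Matrix.single i j 1 * Matrix.single i j 1 : Matrix n n K) = 0 :=
    Matrix.single_mul_single_of_ne _ _ _ _ h.symm _
  constructor <;> simp [mul_add, add_mul, mul_sub, sub_mul, this]

variable {p : FreeAlgebra K (Fin m)}

theorem exists_ncEval_notMem_center {R : Type*} [Ring R] [Algebra K R] (hPI : ¬ IsPIOf p R)
    (hcentral : ¬ IsCentralPolyOf p R) : ∃ a : Fin m → R, ncEval p a ∉ Subalgebra.center K R := by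
  by_contra! h
  exact hcentral ⟨h, hPI⟩

/-- If all values on matrix units were diagonal, all values would be. Conjugating a diagonal matrix
by a transvection produces the difference of two diagonal entries off the diagonal, so all values
would be scalar. -/
theorem IsMultilinearPoly.exists_single_apply_ne_zero (hp : IsMultilinearPoly p) {n : Type*}
    [Fintype n] [DecidableEq n] (hPI : ¬ IsPIOf p (Matrix n n K))
    (hcentral : ¬ IsCentralPolyOf p (Matrix n n K)) :
    ∃ i j : Fin m → n, ∃ a b, a ≠ b ∧
      (ncEval p fun k => Matrix.single (i k) (j k) (1 : K)) a b ≠ 0 := by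
  by_contra! h
  obtain ⟨x, hx⟩ := exists_ncEval_notMem_center hPI hcentral
  let S : Submodule K (Matrix n n K) :=
    { carrier := {M | ∀ a b, a ≠ b → M a b = 0}
      add_mem' := fun hM hN a b hab => by simp [hM a b hab, hN a b hab]
      zero_mem' := fun _ _ _ => rfl
      smul_mem' := fun c M hM a b hab => by simp [hM a b hab] }
  have hS : ∀ y, ncEval p y ∈ S := hp.mem_of_forall_single_mem S h
  refine hx (Matrix.mem_center_of_apply (hS x) fun i j => ?_)
  by_cases hij : i = j
  · rw [hij]
  obtain ⟨h1, h2⟩ := Matrix.one_add_single_mul_one_sub_single (K := K) hij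
  have h3 := conj_ncEval h1 h2 p x ▸ hS _
  have h4 := Matrix.transvection_conj_apply (ncEval p x) i j i j
  rw [h3 i j hij] at h4
  simp [hS x i j hij, hS x j i (Ne.symm hij)] at h4
  linear_combination h4

/-- A value on matrix units is diagonal or has zero diagonal. -/
theorem IsMultilinearPoly.isDiag_of_diag_ne_zero (hp : IsMultilinearPoly p) {n : Type*}
    [Fintype n] [DecidableEq n] {i j : Fin m → n} {a : n}
    (ha : (ncEval p fun k => Matrix.single (i k) (j k) (1 : K)) a a ≠ 0) :
    (ncEval p fun k => Matrix.single (i k) (j k) (1 : K)).IsDiag := by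
  -- With the standard basis vectors as weights, the degree of a matrix unit vanishes only on the
  -- diagonal.
  have h := hp.isWeightHomogeneous (L := K) (w := fun a : n => Pi.single (M := fun _ => ℤ) a 1)
    fun k => Matrix.IsWeightHomogeneous.single (i k) (j k) 1
  have h0 := h a a ha
  rw [sub_self] at h0
  intro b c hbc
  by_contra hne
  have h1 := h b c hne
  rw [← h0, sub_eq_zero] at h1
  have := congrFun h1 b
  simp [hbc] at this

/-- Values on matrix units that are not diagonal have zero diagonal. If the diagonal ones were all
scalar, every value would have constant diagonal, and conjugation invariance would then kill the
off-diagonal entries. -/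
theorem IsMultilinearPoly.exists_single_isDiag (hp : IsMultilinearPoly p)
    (hPI : ¬ IsPIOf p (Matrix (Fin 4) (Fin 4) K))
    (hcentral : ¬ IsCentralPolyOf p (Matrix (Fin 4) (Fin 4) K)) :
    ∃ i j : Fin m → Fin 4, (ncEval p fun k => Matrix.single (i k) (j k) (1 : K)).IsDiag ∧
      ∃ a b, (ncEval p fun k => Matrix.single (i k) (j k) (1 : K)) a a ≠
        (ncEval p fun k => Matrix.single (i k) (j k) (1 : K)) b b := by
  by_contra! h
  obtain ⟨x, hx⟩ := exists_ncEval_notMem_center hPI hcentral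
  let S : Submodule K (Matrix (Fin 4) (Fin 4) K) :=
    { carrier := {M | ∀ a b, M a a = M b b}
      add_mem' := fun hM hN a b => by simp [hM a b, hN a b]
      zero_mem' := fun _ _ => rfl
      smul_mem' := fun c M hM a b => by simp [hM a b] }
  have hS : ∀ y, ncEval p y ∈ S := by
    refine hp.mem_of_forall_single_mem S fun i j => ?_
    by_cases hd : (ncEval p fun k => Matrix.single (i k) (j k) (1 : K)).IsDiag
    · exact h i j hd
    · have h0 : ∀ a, (ncEval p fun k => Matrix.single (i k) (j k) (1 : K)) a a = 0 := by
        intro a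
        by_contra ha
        exact hd (hp.isDiag_of_diag_ne_zero ha)
      intro a b
      rw [h0, h0]
  refine hx (Matrix.mem_center_of_apply (fun i j hij => ?_) (hS x))
  -- The transvection changes the diagonal entry at `i` by `-M i j` and leaves the one at a third
  -- index `k` alone.
  obtain ⟨k, hki, hkj⟩ : ∃ k : Fin 4, k ≠ i ∧ k ≠ j := by decide +revert
  obtain ⟨h1, h2⟩ := Matrix.one_add_single_mul_one_sub_single (K := K) hij.symm
  have h3 := conj_ncEval h1 h2 p x ▸ hS _
  have h4 := Matrix.transvection_conj_apply (ncEval p x) j i i i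
  have h5 := Matrix.transvection_conj_apply (ncEval p x) j i k k
  rw [h3 i k, h5] at h4
  simp [hij, hki, hkj, hS x i k] at h4
  linear_combination h4

end Conjugation

/-! ### Combinations of translated matrix units -/

section Translates

variable {K : Type*} [Field K] {m : ℕ} {G : Type*} [AddCommGroup G]

/-- Translation by `g` on an index type that is identified with the group `G`. -/
def indexTranslate {n : Type*} (φ : n ≃ G) (g : G) : Equiv.Perm n :=
  φ.trans ((Equiv.addRight g).trans φ.symm)

variable {n : Type*} {φ : n ≃ G}

@[simp]
theorem apply_indexTranslate (g : G) (i : n) : φ (indexTranslate φ g i) = φ i + g := by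
  simp [indexTranslate]

theorem indexTranslate_zero (i : n) : indexTranslate φ 0 i = i := by
  simp [indexTranslate]

theorem indexTranslate_add (g h : G) (i : n) :
    indexTranslate φ (g + h) i = indexTranslate φ h (indexTranslate φ g i) := by
  simp [indexTranslate, add_assoc]

variable [Fintype G] [DecidableEq G] [DecidableEq n] {L : Type*} [CommRing L]

/-- The linear combination, with coefficients `u`, of the translates of the matrix unit at
`(i, j)`. -/
def translateComb (φ : n ≃ G) (i j : n) (u : G → L) : Matrix n n L :=
  ∑ g, u g • Matrix.single (indexTranslate φ g i) (indexTranslate φ g j) 1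

theorem translateComb_pi_single (i j : n) :
    translateComb φ i j (Pi.single 0 1 : G → L) = Matrix.single i j 1 := by
  rw [translateComb, Finset.sum_eq_single 0]
  · simp [indexTranslate_zero]
  · intro g _ hg
    simp [hg]
  · simp

theorem translateComb_submatrix (i j : n) (u : G → L) (h : G) :
    (translateComb φ i j fun g => u (g - h)).submatrix (indexTranslate φ h) (indexTranslate φ h) =
      translateComb φ i j u := by
  ext a b
  simp only [translateComb, Matrix.submatrix_apply, Matrix.sum_apply, Matrix.smul_apply]
  rw [← Equiv.sum_comp (Equiv.addRight h)]
  refine Finset.sum_congr rfl fun g _ => ?_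
  simp [Matrix.single_apply, indexTranslate_add]

/-- Translates of a matrix unit all have the same degree for the weight `φ`. So passing from matrix
units to combinations of translates keeps the degree of the value of a multilinear polynomial, hence
its support pattern. -/
theorem translateComb_isWeightHomogeneous (i j : n) (u : G → L) :
    (translateComb φ i j u).IsWeightHomogeneous φ (φ j - φ i) := by
  refine .sum fun g _ => .smul ?_ _
  have := Matrix.IsWeightHomogeneous.single (w := φ) (indexTranslate φ g i) (indexTranslate φ g j) (1 : L)
  simpa using this

/-- `translateComb` as a linear map. -/
def translateCombLin (L : Type*) [CommRing L] (φ : n ≃ G) (i j : n) : (G → L) →ₗ[L] Matrix n n L where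
  toFun := translateComb φ i j
  map_add' u v := by simp [translateComb, add_smul, Finset.sum_add_distrib]
  map_smul' c u := by simp [translateComb, Finset.smul_sum, mul_smul]

variable [Fintype n] [Algebra K L]

theorem submatrix_ncEval {p : FreeAlgebra K (Fin m)} (σ : Equiv.Perm n) (a : Fin m → Matrix n n L) :
    (ncEval p a).submatrix σ σ = ncEval p fun k => (a k).submatrix σ σ :=
  map_ncEval ((Matrix.reindexAlgEquiv K L σ.symm : Matrix n n L ≃ₐ[K] Matrix n n L) :
    Matrix n n L →ₐ[K] Matrix n n L) p a

/-- The value of `p` on linear combinations of translates of matrix units. -/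
def translateValue (p : FreeAlgebra K (Fin m)) (φ : n ≃ G) (i j : Fin m → n) (u : Fin m → G → L) :
    Matrix n n L :=
  ncEval p fun k => translateComb φ (i k) (j k) (u k)

variable {p : FreeAlgebra K (Fin m)} {i j : Fin m → n}

theorem translateValue_pi_single :
    translateValue p φ i j (fun _ => (Pi.single 0 1 : G → L)) =
      ncEval p fun k => Matrix.single (i k) (j k) (1 : L) := by
  simp [translateValue, translateComb_pi_single]

theorem translateValue_translate (u : Fin m → G → L) (h : G) (a b : n) :
    translateValue p φ i j (fun k g => u k (g - h)) (indexTranslate φ h a) (indexTranslate φ h b) =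
      translateValue p φ i j u a b := by
  have := submatrix_ncEval (p := p) (indexTranslate φ h)
    fun k => translateComb φ (i k) (j k) fun g => u k (g - h)
  simp only [translateComb_submatrix] at this
  exact congrFun (congrFun this a) b

theorem IsMultilinearPoly.translateValue_isWeightHomogeneous (hp : IsMultilinearPoly p)
    (u : Fin m → G → L) :
    (translateValue p φ i j u).IsWeightHomogeneous φ (∑ k, (φ (j k) - φ (i k))) :=
  hp.isWeightHomogeneous fun _ => translateComb_isWeightHomogeneous _ _ _

theorem IsMultilinearPoly.exists_multilinearMap_translateValue (hp : IsMultilinearPoly p) :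
    ∃ f : MultilinearMap L (fun _ : Fin m => G → L) (Matrix n n L),
      ∀ u, f u = translateValue p φ i j u := by
  obtain ⟨f, hf⟩ := hp.exists_multilinearMap L (Matrix n n L)
  exact ⟨f.compLinearMap fun k => translateCombLin L φ (i k) (j k), fun u => hf _⟩

theorem map_translateValue {L' : Type*} [CommRing L'] [Algebra K L'] (ψ : L →ₐ[K] L')
    (u : Fin m → G → L) :
    (translateValue p φ i j u).map ψ = translateValue p φ i j fun k g => ψ (u k g) := by
  have := map_ncEval ψ.mapMatrix p fun k => translateComb φ (i k) (j k) (u k)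
  rw [translateValue, translateValue]
  convert! this using 3 with k
  ext a b
  simp [translateComb, Matrix.sum_apply, Matrix.single_apply]

/-- The value of `p` on generic linear combinations of translates of matrix units. -/
noncomputable def genericTranslateValue (p : FreeAlgebra K (Fin m)) (φ : n ≃ G) (i j : Fin m → n) :
    Matrix n n (MvPolynomial (Fin m × G) K) :=
  translateValue p φ i j fun k g => MvPolynomial.X (k, g)

theorem aeval_genericTranslateValue (u : Fin m → G → L) (a b : n) :
    MvPolynomial.aeval (fun kg : Fin m × G => u kg.1 kg.2) (genericTranslateValue p φ i j a b) =
      translateValue p φ i j u a b := by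
  have := map_translateValue (p := p) (φ := φ) (i := i) (j := j)
    (MvPolynomial.aeval fun kg : Fin m × G => u kg.1 kg.2) fun k g => MvPolynomial.X (R := K) (k, g)
  simp only [MvPolynomial.aeval_X] at this
  exact congrFun (congrFun this a) b

/-- Translating the variables permutes the entries of the generic value. -/
theorem genericTranslateValue_translate (h : G) (a b : n) :
    MvPolynomial.aeval (fun kg : Fin m × G => MvPolynomial.X (R := K) (kg.1, kg.2 - h))
      (genericTranslateValue p φ i j (indexTranslate φ h a) (indexTranslate φ h b)) =
      genericTranslateValue p φ i j a b := by
  rw [aeval_genericTranslateValue (fun k g => MvPolynomial.X (R := K) (k, g - h)),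
    translateValue_translate (fun k g => MvPolynomial.X (R := K) (k, g)) h]
  rfl

end Translates

/-! ### A value supported on a full cycle -/

section Cyclic

variable {K : Type*} [Field K] [Infinite K] {m : ℕ} {p : FreeAlgebra K (Fin m)}

/-- A noncentral multilinear polynomial takes a monomial matrix of a full cycle as a value. -/
theorem IsMultilinearPoly.exists_cyclic_mem_imageOf (hp : IsMultilinearPoly p)
    (hPI : ¬ IsPIOf p (Matrix (Fin 4) (Fin 4) K))
    (hcentral : ¬ IsCentralPolyOf p (Matrix (Fin 4) (Fin 4) K)) :
    ∃ c : Fin 4 → K, (∀ i, c i ≠ 0) ∧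
      !![0, c 0, 0, 0; 0, 0, c 1, 0; 0, 0, 0, c 2; c 3, 0, 0, 0] ∈
        imageOf p (Matrix (Fin 4) (Fin 4) K) := by
  obtain ⟨i, j, a, b, hab, h⟩ := hp.exists_single_apply_ne_zero hPI hcentral
  -- The labelling gives the nonzero entry `(a, b)` degree 1 in `ZMod 4`, so every value of the
  -- family is supported on one 4-cycle.
  obtain ⟨τ, ha, hb⟩ : ∃ τ : Equiv.Perm (Fin 4), τ a = 0 ∧ τ b = 1 := by
    clear h; decide +revert
  let φ : Fin 4 ≃ ZMod 4 := τ
  have hdeg : ∑ k, (φ (j k) - φ (i k)) = 1 := by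
    rw [← translateValue_pi_single (φ := φ)] at h
    rw [← hp.translateValue_isWeightHomogeneous _ a b h]
    change τ b - τ a = 1
    rw [ha, hb]; rfl
  -- Translation of the variables carries the entry `(a, b)` to the other entries of the cycle, so
  -- all four are nonzero polynomials, and over an infinite field they are nonzero at a common
  -- point.
  have hne : ∀ g, genericTranslateValue p φ i j (indexTranslate φ g a) (indexTranslate φ g b) ≠ 0 := by
    intro g h0
    have h1 := genericTranslateValue_translate (p := p) (i := i) (j := j) (φ := φ) g a b
    rw [h0, map_zero] at h1
    have h2 := aeval_genericTranslateValue (p := p) (i := i) (j := j) (φ := φ)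
      (fun _ => (Pi.single 0 1 : ZMod 4 → K)) a b
    rw [← h1, translateValue_pi_single, map_zero] at h2
    exact h h2.symm
  have hprod := Finset.prod_ne_zero_iff.mpr fun g (_ : g ∈ Finset.univ) => hne g
  obtain ⟨u, hu⟩ : ∃ u : Fin m × ZMod 4 → K, MvPolynomial.eval u
      (∏ g, genericTranslateValue p φ i j (indexTranslate φ g a) (indexTranslate φ g b)) ≠ 0 := by
    by_contra! hcon
    exact hprod (MvPolynomial.funext fun u => by rw [hcon u, map_zero])
  rw [map_prod, Finset.prod_ne_zero_iff] at hu
  let M := translateValue (L := K) p φ i j fun k g => u (k, g)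
  have hM : ∀ g, M (indexTranslate φ g a) (indexTranslate φ g b) ≠ 0 := by
    intro g
    change translateValue (L := K) p φ i j (fun k g => u (k, g)) _ _ ≠ 0
    rw [← aeval_genericTranslateValue (fun k g => u (k, g))]
    exact hu g (Finset.mem_univ _)
  have hM0 : ∀ x y, y ≠ x + 1 → M (τ.symm x) (τ.symm y) = 0 := by
    intro x y hxy
    by_contra h0
    have := hp.translateValue_isWeightHomogeneous _ _ _ h0
    rw [hdeg] at this
    change τ (τ.symm y) - τ (τ.symm x) = 1 at this
    simp only [Equiv.apply_symm_apply, sub_eq_iff_eq_add'] at this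
    exact hxy this
  have hM1 : ∀ x, M (τ.symm x) (τ.symm (x + 1)) ≠ 0 := by
    intro x
    convert! hM x using 2
    · rw [Equiv.symm_apply_eq]
      exact ((apply_indexTranslate (φ := φ) x a).trans (by change τ a + x = x; simp [ha])).symm
    · rw [Equiv.symm_apply_eq]
      exact ((apply_indexTranslate (φ := φ) x b).trans
        (by change τ b + x = x + 1; rw [hb, add_comm])).symm
  refine ⟨fun x => M (τ.symm x) (τ.symm (x + 1)), hM1, ?_⟩
  refine ⟨_, (submatrix_ncEval (p := p) τ.symm _).symm.trans (?_ : M.submatrix τ.symm τ.symm = _)⟩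
  ext x y
  fin_cases x <;> fin_cases y <;> first | rfl | exact hM0 _ _ (by decide)

end Cyclic

/-! ### Characteristic coefficients -/

section Invariants

variable {L : Type*} [CommRing L]

/-- The elementary symmetric functions of the eigenvalues of a `4 × 4` matrix. -/
noncomputable def charInvariants (M : Matrix (Fin 4) (Fin 4) L) (k : Fin 4) : L :=
  (-1) ^ (k.val + 1) * M.charpoly.coeff (3 - k)

theorem charInvariants_map {L' : Type*} [CommRing L'] (ψ : L →+* L') (M : Matrix (Fin 4) (Fin 4) L) :
    charInvariants (M.map ψ) = fun k => ψ (charInvariants M k) := by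
  ext k
  simp [charInvariants, Matrix.charpoly_map]

theorem charInvariants_conj {h h' : Matrix (Fin 4) (Fin 4) L} (hh : h * h' = 1)
    (M : Matrix (Fin 4) (Fin 4) L) : charInvariants (h * M * h') = charInvariants M := by
  have : (h * M * h').charpoly = M.charpoly := by
    rw [Matrix.charpoly_mul_comm, ← Matrix.mul_assoc, mul_eq_one_comm.mp hh, Matrix.one_mul]
  ext k
  rw [charInvariants, charInvariants, this]

theorem charInvariants_diagonal {K : Type*} [CommRing K] [Algebra K L] (z : Fin 4 → L) :
    charInvariants (Matrix.diagonal z) =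
      fun k => MvPolynomial.aeval z (MvPolynomial.esymm (Fin 4) K (k.val + 1)) := by
  ext k
  rw [charInvariants, Matrix.charpoly_diagonal, MvPolynomial.aeval_esymm_eq_multiset_esymm]
  have := Multiset.prod_X_sub_C_coeff (Finset.univ.val.map z) (k := 3 - k)
    (by simp; omega)
  simp only [Multiset.map_map, Function.comp_def, Multiset.card_map, Finset.card_val,
    Finset.card_univ, Fintype.card_fin] at this
  rw [Finset.prod_eq_multiset_prod, this]
  have h4 : 4 - (3 - k.val) = k.val + 1 := by omega
  rw [h4, ← mul_assoc, ← mul_pow]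
  simp

end Invariants

/-! ### The generic value and relations between values -/

section Generic

variable {K : Type*} [Field K] {m : ℕ}

/-- The value of a noncommutative polynomial on generic matrices. -/
noncomputable def genericValue (p : FreeAlgebra K (Fin m)) :
    Matrix (Fin 4) (Fin 4) (MvPolynomial (Fin m × Fin 4 × Fin 4) K) :=
  ncEval p fun k => Matrix.of fun i j => MvPolynomial.X (k, i, j)

variable {L : Type*} [CommRing L] [Algebra K L]

theorem map_ncEval_matrix {n L' : Type*} [Fintype n] [DecidableEq n] [CommRing L'] [Algebra K L']
    (ψ : L →ₐ[K] L') (p : FreeAlgebra K (Fin m)) (a : Fin m → Matrix n n L) :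
    (ncEval p a).map ψ = ncEval p fun k => (a k).map ψ :=
  map_ncEval ψ.mapMatrix p a

theorem map_genericValue (p : FreeAlgebra K (Fin m)) (a : Fin m → Matrix (Fin 4) (Fin 4) L) :
    (genericValue p).map (MvPolynomial.aeval (R := K) fun s : Fin m × Fin 4 × Fin 4 => a s.1 s.2.1 s.2.2) =
      ncEval p a := by
  refine (map_ncEval_matrix _ p _).trans (congrArg (ncEval p) ?_)
  ext k i j
  simp

/-- A polynomial relation between the entries of the generic value holds for all values. -/
theorem aeval_ncEval_eq_zero {p : FreeAlgebra K (Fin m)} {F : MvPolynomial (Fin 4 × Fin 4) K}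
    (hF : MvPolynomial.aeval (fun s : Fin 4 × Fin 4 => genericValue p s.1 s.2) F = 0)
    (a : Fin m → Matrix (Fin 4) (Fin 4) L) :
    MvPolynomial.aeval (fun s : Fin 4 × Fin 4 => ncEval p a s.1 s.2) F = 0 := by
  rw [← map_genericValue p a]
  have := congrArg (MvPolynomial.aeval (R := K)
    fun s : Fin m × Fin 4 × Fin 4 => a s.1 s.2.1 s.2.2) hF
  rwa [MvPolynomial.comp_aeval_apply, map_zero] at this

/-- A polynomial relation between the characteristic coefficients of the generic value holds for
all values. -/
theorem aeval_charInvariants_ncEval {p : FreeAlgebra K (Fin m)} {F : MvPolynomial (Fin 4) K}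
    (hF : MvPolynomial.aeval (charInvariants (genericValue p)) F = 0)
    (a : Fin m → Matrix (Fin 4) (Fin 4) L) :
    MvPolynomial.aeval (charInvariants (ncEval p a)) F = 0 := by
  rw [← map_genericValue p a]
  have := congrArg (MvPolynomial.aeval (R := K)
    fun s : Fin m × Fin 4 × Fin 4 => a s.1 s.2.1 s.2.2) hF
  rw [MvPolynomial.comp_aeval_apply, map_zero] at this
  rw [← this]
  congr 2
  exact charInvariants_map (MvPolynomial.aeval (R := K)
    fun s : Fin m × Fin 4 × Fin 4 => a s.1 s.2.1 s.2.2).toRingHom _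

variable [Infinite K] {p : FreeAlgebra K (Fin m)}

/-- Over an infinite field a polynomial is determined by its values, so the relations on the image
are those of the generic value. This embeds the coordinate ring of the image in a polynomial ring.
-/
theorem mem_matrixVanishingIdeal_imageOf {F : MvPolynomial (Fin 4 × Fin 4) K} :
    F ∈ matrixVanishingIdeal (imageOf p (Matrix (Fin 4) (Fin 4) K)) ↔
      MvPolynomial.aeval (fun s : Fin 4 × Fin 4 => genericValue p s.1 s.2) F = 0 := by
  rw [matrixVanishingIdeal, MvPolynomial.mem_vanishingIdeal_iff]
  constructor
  · intro h
    refine MvPolynomial.funext fun u => ?_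
    have h1 := h _ ⟨_, ⟨fun k => Matrix.of fun i j => u (k, i, j), rfl⟩, rfl⟩
    rw [← map_genericValue] at h1
    rw [map_zero, ← h1]
    change MvPolynomial.aeval (R := K) u _ = _
    rw [MvPolynomial.comp_aeval_apply]
    rfl
  · rintro h _ ⟨_, ⟨a, rfl⟩, rfl⟩
    exact aeval_ncEval_eq_zero h a

end Generic

/-! ### Krylov matrices and cyclic vectors -/

section Krylov

variable {L : Type*} [CommRing L]

/-- The Krylov matrix with columns `e₀, M e₀, M² e₀, M³ e₀`. -/
def krylov (M : Matrix (Fin 4) (Fin 4) L) : Matrix (Fin 4) (Fin 4) L :=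
  Matrix.of fun a k => (M ^ k.val) a 0

theorem krylov_map {L' : Type*} [CommRing L'] (ψ : L →+* L') (M : Matrix (Fin 4) (Fin 4) L) :
    krylov (M.map ψ) = (krylov M).map ψ := by
  ext a k
  have := map_pow ψ.mapMatrix M k.val
  exact (congrFun (congrFun this a) 0).symm

/-- The powers of a weighted 4-cycle move `e₀` through all basis vectors, so the Krylov matrix is
monomial. -/
theorem det_krylov_cyclic (c : Fin 4 → L) :
    (krylov !![0, c 0, 0, 0; 0, 0, c 1, 0; 0, 0, 0, c 2; c 3, 0, 0, 0]).det =
      - (c 3 * (c 2 * c 3) * (c 1 * (c 2 * c 3))) := by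
  have : krylov !![0, c 0, 0, 0; 0, 0, c 1, 0; 0, 0, 0, c 2; c 3, 0, 0, 0] =
      !![1, 0, 0, 0; 0, 0, 0, c 1 * (c 2 * c 3); 0, 0, c 2 * c 3, 0; 0, c 3, 0, 0] := by
    ext a k
    fin_cases a <;> fin_cases k <;>
      simp [krylov, pow_succ, Matrix.mul_apply, Fin.sum_univ_four, mul_assoc]
  rw [this]
  simp [Matrix.det_succ_row_zero, Fin.sum_univ_succ, Fin.succAbove]
  ring

/-- A matrix with an invertible Krylov matrix is conjugate to a matrix with any given invertible
Krylov matrix whose first column is `e₀`. -/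
theorem exists_conj_krylov {P g g' : Matrix (Fin 4) (Fin 4) L} {k' : Matrix (Fin 4) (Fin 4) L}
    (hk : krylov P * k' = 1) (hg : g * g' = 1) (h0 : ∀ a, g a 0 = if a = 0 then 1 else 0) :
    ∃ h h' : Matrix (Fin 4) (Fin 4) L, h * h' = 1 ∧ h' * h = 1 ∧ krylov (h * P * h') = g := by
  have hk' := mul_eq_one_comm.mp hk
  have hg' := mul_eq_one_comm.mp hg
  have hh : (g * k') * (krylov P * g') = 1 := by
    rw [Matrix.mul_assoc, ← Matrix.mul_assoc k', hk', Matrix.one_mul, hg]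
  have hh' := mul_eq_one_comm.mp hh
  -- The conjugator carries the Krylov basis of `P` to the columns of `g`. Both bases begin with
  -- `e₀`, so it fixes `e₀`, and conjugation by it multiplies the whole Krylov matrix by it.
  refine ⟨g * k', krylov P * g', hh, hh', ?_⟩
  have hpow : ∀ k : ℕ, (g * k' * P * (krylov P * g')) ^ k = g * k' * P ^ k * (krylov P * g') := by
    intro k
    induction k with
    | zero => simpa using hh.symm
    | succ k ih =>
      rw [pow_succ, ih, pow_succ]
      calc _ = g * k' * P ^ k * ((krylov P * g') * (g * k')) * P * (krylov P * g') := by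
            simp only [Matrix.mul_assoc]
        _ = _ := by rw [hh']; simp only [Matrix.mul_assoc, Matrix.one_mul]
  have hcol : ∀ a, (krylov P * g') a 0 = if a = 0 then 1 else 0 := by
    intro a
    have h1 : ((krylov P * g') * g) a 0 = krylov P a 0 := by
      rw [Matrix.mul_assoc, hg', Matrix.mul_one]
    rw [Matrix.mul_apply] at h1
    simp only [h0, mul_ite, mul_one, mul_zero, Finset.sum_ite_eq', Finset.mem_univ, if_true] at h1
    rw [h1]
    simp [krylov, Matrix.one_apply]
  ext a k
  calc krylov (g * k' * P * (krylov P * g')) a k = (g * k' * P ^ k.val * (krylov P * g')) a 0 := by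
        rw [← hpow]; rfl
    _ = (g * k' * P ^ k.val) a 0 := by
        rw [Matrix.mul_apply]
        simp [hcol]
    _ = (g * k' * krylov P) a k := by
        rw [Matrix.mul_apply, Matrix.mul_apply]; rfl
    _ = g a k := by rw [Matrix.mul_assoc, hk', Matrix.mul_one]

end Krylov

/-! ### Lower bound for the dimension of the image -/

section Dimension

variable {K : Type*} [Field K] [Infinite K] {m : ℕ} {p : FreeAlgebra K (Fin m)}

theorem IsMultilinearPoly.det_krylov_genericValue_ne_zero (hp : IsMultilinearPoly p)
    (hPI : ¬ IsPIOf p (Matrix (Fin 4) (Fin 4) K))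
    (hcentral : ¬ IsCentralPolyOf p (Matrix (Fin 4) (Fin 4) K)) :
    (krylov (genericValue p)).det ≠ 0 := by
  obtain ⟨c, hc, a, ha⟩ := hp.exists_cyclic_mem_imageOf hPI hcentral
  intro h
  have h1 := det_krylov_cyclic c
  rw [← ha, ← map_genericValue p a] at h1
  have h2 := krylov_map (MvPolynomial.aeval (R := K)
    fun s : Fin m × Fin 4 × Fin 4 => a s.1 s.2.1 s.2.2).toRingHom (genericValue p)
  have h3 := congrArg Matrix.det h2
  rw [← RingHom.mapMatrix_apply, ← RingHom.mapMatrix_apply, ← RingHom.map_det, h, map_zero] at h3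
  have h4 := h3.symm.trans h1
  simp [hc] at h4

/-- The coordinate ring of the image of `p` is a domain. -/
theorem isPrime_matrixVanishingIdeal_imageOf :
    (matrixVanishingIdeal (imageOf p (Matrix (Fin 4) (Fin 4) K))).IsPrime := by
  have : matrixVanishingIdeal (imageOf p (Matrix (Fin 4) (Fin 4) K)) =
      RingHom.ker (MvPolynomial.aeval (R := K)
        fun s : Fin 4 × Fin 4 => genericValue p s.1 s.2) := by
    ext F
    exact mem_matrixVanishingIdeal_imageOf
  rw [this]
  exact RingHom.ker_isPrime _

/-- Algebraically independent polynomials in the characteristic coefficients of the generic value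
bound the dimension of the image from below. -/
theorem IsMultilinearPoly.add_card_le_zariskiDim (hp : IsMultilinearPoly p)
    (hPI : ¬ IsPIOf p (Matrix (Fin 4) (Fin 4) K))
    (hcentral : ¬ IsCentralPolyOf p (Matrix (Fin 4) (Fin 4) K)) {ι : Type*} [Fintype ι]
    {f : ι → MvPolynomial (Fin 4) K} (hf : AlgebraicIndependent K fun t =>
      MvPolynomial.aeval (charInvariants (genericValue p)) (f t)) :
    ((12 + Fintype.card ι : ℕ) : WithBot ℕ∞) ≤
      zariskiDim (imageOf p (Matrix (Fin 4) (Fin 4) K)) := by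
  have := isPrime_matrixVanishingIdeal_imageOf (p := p)
  let I := matrixVanishingIdeal (imageOf p (Matrix (Fin 4) (Fin 4) K))
  let U : Matrix (Fin 4) (Fin 4) (MvPolynomial (Fin 4 × Fin 4) K) :=
    Matrix.of fun i j => MvPolynomial.X (i, j)
  -- Twelve functions from the Krylov columns after the constant first one, and the given functions
  -- of the spectrum.
  let F : (Fin 3 × Fin 4) ⊕ ι → MvPolynomial (Fin 4 × Fin 4) K :=
    Sum.elim (fun s => krylov U s.2 s.1.succ) fun t => MvPolynomial.aeval (charInvariants U) (f t)
  suffices h : AlgebraicIndependent K fun s => Ideal.Quotient.mkₐ K I (F s) by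
    have h1 := h.card_le_ringKrullDim
    simpa [Fintype.card_sum, zariskiDim, I] using h1
  rw [algebraicIndependent_iff]
  intro H hH
  rw [← MvPolynomial.comp_aeval_apply] at hH
  have hH1 := mem_matrixVanishingIdeal_imageOf.mp (Ideal.Quotient.eq_zero_iff_mem.mp hH)
  -- Over the function field `Ω` of the generic entries, the spectral functions become constants `c`
  -- that are independent over `K`; twelve new variables are independent over `Ω`. It suffices that
  -- `H` vanishes at these variables together with `c`.
  let Ω := FractionRing (MvPolynomial (Fin m × Fin 4 × Fin 4) K)
  let ψ : MvPolynomial (Fin m × Fin 4 × Fin 4) K →ₐ[K] Ω := IsScalarTower.toAlgHom K _ Ω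
  let a0 : Fin m → Matrix (Fin 4) (Fin 4) Ω := fun k => Matrix.of fun i j =>
    ψ (MvPolynomial.X (k, i, j))
  let c : ι → Ω := fun t => MvPolynomial.aeval (charInvariants (ncEval p a0)) (f t)
  have hP : ncEval p a0 = (genericValue p).map ψ := by
    refine ((map_ncEval_matrix ψ p _).trans (congrArg (ncEval p) ?_)).symm
    ext k i j
    simp [a0]
  have hc : AlgebraicIndependent K c := by
    have h1 : c = ψ ∘ fun t => MvPolynomial.aeval (charInvariants (genericValue p)) (f t) := by
      funext t
      simp only [Function.comp_apply, MvPolynomial.comp_aeval_apply, c, hP]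
      exact congrArg (fun z => MvPolynomial.aeval z (f t)) (charInvariants_map ψ.toRingHom _)
    rw [h1]
    exact hf.map' (IsFractionRing.injective _ Ω)
  have hind : AlgebraicIndependent K (Sum.elim (MvPolynomial.X (R := Ω) (σ := Fin 3 × Fin 4))
      (algebraMap Ω _ ∘ c)) :=
    hc.sumElim_comp (MvPolynomial.algebraicIndependent_X _ _)
  apply hind
  rw [map_zero]
  let g : Matrix (Fin 4) (Fin 4) (MvPolynomial (Fin 3 × Fin 4) Ω) := Matrix.of fun a k =>
    Fin.cases (if a = 0 then 1 else 0) (fun s => MvPolynomial.X (s, a)) k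
  have hg : g.det ≠ 0 := by
    intro h0
    have h1 := congrArg (MvPolynomial.eval fun s : Fin 3 × Fin 4 =>
      if s.2 = s.1.succ then (1 : Ω) else 0) h0
    rw [RingHom.map_det, map_zero] at h1
    have h2 : (MvPolynomial.eval fun s : Fin 3 × Fin 4 =>
        if s.2 = s.1.succ then (1 : Ω) else 0).mapMatrix g = 1 := by
      ext a k
      refine Fin.cases ?_ (fun s => ?_) k
      · by_cases ha : a = 0 <;> simp [g, ha, Matrix.one_apply]
      · simp [g, Matrix.one_apply]
    rw [h2, Matrix.det_one] at h1
    exact one_ne_zero h1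
  -- The factor `g.det` leaves only points `y` where `g` is invertible. There a conjugate of the
  -- generic value, again a value of `p`, has Krylov matrix `g` at `y` and unchanged spectral
  -- functions, so `H` vanishes.
  refine (mul_eq_zero.mp (?_ : _ * g.det = 0)).resolve_right hg
  have : Infinite Ω := Infinite.of_injective _ (algebraMap K Ω).injective
  refine MvPolynomial.funext fun y => ?_
  rw [map_mul, map_zero, mul_eq_zero, or_iff_not_imp_right]
  intro hy
  rw [RingHom.map_det] at hy
  have hk : (krylov (ncEval p a0)).det ≠ 0 := by
    have h1 : krylov (ncEval p a0) = ψ.toRingHom.mapMatrix (krylov (genericValue p)) := by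
      rw [hP]; exact krylov_map ψ.toRingHom _
    rw [h1, ← RingHom.map_det]
    exact (map_ne_zero_iff _ (IsFractionRing.injective _ Ω)).mpr
      (hp.det_krylov_genericValue_ne_zero hPI hcentral)
  obtain ⟨h, h', hh, hh', hM⟩ := exists_conj_krylov (Matrix.mul_nonsing_inv _ hk.isUnit)
    (Matrix.mul_nonsing_inv _ (Ne.isUnit hy)) (fun a => by by_cases ha : a = 0 <;> simp [g, ha])
  have hsig := charInvariants_conj hh (ncEval p a0)
  have hval := aeval_ncEval_eq_zero hH1 fun k => h * a0 k * h'
  rw [← conj_ncEval hh hh', MvPolynomial.comp_aeval_apply] at hval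
  set M := h * ncEval p a0 * h'
  have hU : U.map (MvPolynomial.aeval (R := K) fun s : Fin 4 × Fin 4 => M s.1 s.2) = M := by
    ext a b
    simp [U]
  change (MvPolynomial.aeval (R := Ω) y).restrictScalars K _ = 0
  rw [MvPolynomial.comp_aeval_apply, ← hval]
  congr 2
  funext s
  rcases s with ⟨s, a⟩ | t
  · have h1 := krylov_map (MvPolynomial.aeval (R := K) fun s : Fin 4 × Fin 4 => M s.1 s.2).toRingHom U
    have h2 := congrFun (congrFun (h1.symm.trans ((congrArg krylov hU).trans hM)) a) s.succ
    refine Eq.trans ?_ h2.symm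
    simp [g]
  · have h1 := charInvariants_map
      (MvPolynomial.aeval (R := K) fun s : Fin 4 × Fin 4 => M s.1 s.2).toRingHom U
    have h2 := h1.symm.trans ((congrArg charInvariants hU).trans hsig)
    simp only [F, Sum.elim_inr, MvPolynomial.comp_aeval_apply]
    refine Eq.trans ?_ (congrArg (fun z => MvPolynomial.aeval z (f t)) h2.symm)
    exact (MvPolynomial.aeval (R := Ω) y).commutes (c t)

end Dimension

/-! ### Independent values of a multilinear map -/

section Slots

/-- If a multilinear map over an infinite field takes two linearly independent values, then it
takes two linearly independent values at arguments that differ in one slot. -/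
theorem MultilinearMap.exists_linearIndependent_update {K V W ι : Type*} [Field K] [Infinite K]
    [AddCommGroup V] [Module K V] [AddCommGroup W] [Module K W] [DecidableEq ι] [Fintype ι]
    (f : MultilinearMap K (fun _ : ι => V) W) {a b : ι → V}
    (hab : LinearIndependent K ![f a, f b]) :
    ∃ (u : ι → V) (i : ι) (v : V), LinearIndependent K ![f u, f (Function.update u i v)] := by
  suffices h : ∀ (s : Finset ι) (a b : ι → V), (∀ i ∉ s, a i = b i) →
      LinearIndependent K ![f a, f b] →
      ∃ (u : ι → V) (i : ι) (v : V), LinearIndependent K ![f u, f (Function.update u i v)] from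
    h Finset.univ a b (by simp) hab
  intro s
  induction s using Finset.induction_on with
  | empty =>
    intro a b h hab
    rw [funext fun i => h i (by simp)] at hab
    simpa using hab.injective.ne (show (0 : Fin 2) ≠ 1 by decide)
  | insert i s hi ih =>
    intro a b h hab
    by_contra! hcon
    have ha : f a ≠ 0 := hab.ne_zero 0
    have hb : f b ≠ 0 := hab.ne_zero 1
    have hw : ∀ t : K, f (Function.update a i (a i + t • b i)) =
        f a + t • f (Function.update a i (b i)) := by
      intro t; simp
    have hz : ∀ t : K, f (Function.update b i (a i + t • b i)) =
        f (Function.update b i (a i)) + t • f b := by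
      intro t; simp
    -- Each condition excludes at most one `t`.
    obtain ⟨t, ht1, ht2⟩ : ∃ t : K, f (Function.update a i (a i + t • b i)) ≠ 0 ∧
        f (Function.update b i (a i + t • b i)) ≠ 0 := by
      have h1 : {t : K | f a + t • f (Function.update a i (b i)) = 0}.Subsingleton := by
        intro t ht t' ht'
        by_contra hne
        have h0 : (t - t') • f (Function.update a i (b i)) = 0 := by
          rw [sub_smul, ← add_sub_add_left_eq_sub _ _ (f a), ht, ht', sub_zero]
        rw [smul_eq_zero, sub_eq_zero] at h0
        have := h0.resolve_left hne
        simp [this] at ht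
        exact ha ht
      have h2 : {t : K | f (Function.update b i (a i)) + t • f b = 0}.Subsingleton := by
        intro t ht t' ht'
        have h0 : (t - t') • f b = 0 := by
          rw [sub_smul, ← add_sub_add_left_eq_sub _ _ (f (Function.update b i (a i))), ht, ht',
            sub_zero]
        rw [smul_eq_zero, sub_eq_zero] at h0
        exact h0.resolve_right hb
      obtain ⟨t, ht⟩ := (h1.finite.union h2.finite).infinite_compl.nonempty
      simp only [Set.mem_compl_iff, Set.mem_union, not_or] at ht
      exact ⟨t, by rw [hw]; exact ht.1, by rw [hz]; exact ht.2⟩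
    -- Put the mixed vector `a i + t • b i` in slot `i` of both `a` and `b`. In the chain `a`, mixed
    -- `a`, mixed `b`, `b`, the outer steps change only slot `i`, and the middle step is covered by
    -- induction. So `f a` and `f b` would be proportional.
    have h1 := hcon a i (a i + t • b i)
    have h2 := hcon (Function.update b i (a i + t • b i)) i (b i)
    rw [Function.update_idem, Function.update_eq_self] at h2
    have h3 := mt (ih (Function.update a i (a i + t • b i)) (Function.update b i (a i + t • b i))
      (by
        intro k hk
        by_cases hki : k = i
        · subst hki; simp
        · simp [hki, h k (by simp [hki, hk])])) (by push Not; exact hcon)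
    rw [LinearIndependent.pair_iff' ha] at h1 hab
    rw [LinearIndependent.pair_iff' ht2] at h2
    rw [LinearIndependent.pair_iff' ht1] at h3
    push Not at h1 h2 h3
    obtain ⟨c1, h1⟩ := h1
    obtain ⟨c2, h2⟩ := h2
    obtain ⟨c3, h3⟩ := h3
    apply hab (c2 * c3 * c1)
    rw [mul_smul, mul_smul, h1, h3, h2]

end Slots

/-! ### Planes of spectra -/

section Pencil

variable {K : Type*} [Field K] {L : Type*} [CommRing L] [Algebra K L]

/-- Each `z k` is a root of the characteristic polynomial, which is monic with the invariants as
coefficients up to sign. -/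
theorem isIntegral_charInvariants_diagonal (z : Fin 4 → L) (k : Fin 4) :
    IsIntegral (MvPolynomial.aeval (R := K) (charInvariants (Matrix.diagonal z))).range (z k) := by
  set S := (MvPolynomial.aeval (R := K) (charInvariants (Matrix.diagonal z))).range
  have hlift : (Matrix.diagonal z).charpoly ∈ Polynomial.lifts (algebraMap S L) := by
    rw [Polynomial.lifts_iff_coeff_lifts]
    intro n
    by_cases hn : n < 4
    · have h1 : (Matrix.diagonal z).charpoly.coeff n = (-1) ^ ((3 - n) + 1) *
          charInvariants (Matrix.diagonal z) ⟨3 - n, by omega⟩ := by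
        have h3 : 3 - (3 - n) = n := by omega
        simp only [charInvariants, h3, ← mul_assoc, ← mul_pow]
        simp
      have h2 : (Matrix.diagonal z).charpoly.coeff n ∈ S := by
        rw [h1]
        refine S.mul_mem (S.pow_mem (S.neg_mem S.one_mem) _) ⟨MvPolynomial.X ⟨3 - n, by omega⟩, ?_⟩
        exact MvPolynomial.aeval_X _ _
      exact ⟨⟨_, h2⟩, rfl⟩
    · nontriviality L
      have hdeg := (Matrix.diagonal z).charpoly_natDegree_eq_dim
      rw [Fintype.card_fin] at hdeg
      rcases eq_or_lt_of_le (not_lt.mp hn) with rfl | h4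
      · refine ⟨1, ?_⟩
        have := (Matrix.charpoly_monic (Matrix.diagonal z)).coeff_natDegree
        rw [hdeg] at this
        rw [map_one, this]
      · refine ⟨0, ?_⟩
        rw [map_zero, Polynomial.coeff_eq_zero_of_natDegree_lt (by omega)]
  obtain ⟨Q, hQ, -, hmonic⟩ := Polynomial.lifts_and_natDegree_eq_and_monic hlift
    (Matrix.charpoly_monic _)
  refine ⟨Q, hmonic, ?_⟩
  rw [← Polynomial.eval_map, hQ, Matrix.charpoly_diagonal, Polynomial.eval_prod]
  exact Finset.prod_eq_zero (Finset.mem_univ k) (by simp)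

/-- The generic linear combination of two vectors. -/
noncomputable def genericPencil (v w : Fin 4 → K) (k : Fin 4) : MvPolynomial (Fin 2) K :=
  v k • MvPolynomial.X 0 + w k • MvPolynomial.X 1

variable {v w : Fin 4 → K}

/-- By independence of `v` and `w`, both variables are combinations of the diagonal entries of the
pencil, hence integral over the algebra generated by its characteristic coefficients. That algebra
therefore has transcendence degree 2. -/
theorem exists_algebraicIndependent_pencil (h : LinearIndependent K ![v, w]) :
    ∃ f : Fin 2 → MvPolynomial (Fin 4) K, AlgebraicIndependent K fun t =>
      MvPolynomial.aeval (charInvariants (Matrix.diagonal (genericPencil v w))) (f t) := by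
  set θ := MvPolynomial.aeval (R := K) (charInvariants (Matrix.diagonal (genericPencil v w))) with hθ
  have hX : ∀ t : Fin 2, IsIntegral θ.range (MvPolynomial.X (R := K) t) := by
    intro t
    obtain ⟨g, hg⟩ := LinearMap.exists_leftInverse_of_injective (Fintype.linearCombination K ![v, w])
      (LinearMap.ker_eq_bot.mpr (linearIndependent_iff_injective_fintypeLinearCombination.mp h))
    have h1 : ∀ s : Fin 2, g (![v, w] s) t = if s = t then 1 else 0 := by
      intro s
      have := congrFun (LinearMap.congr_fun hg (Pi.single s 1)) t
      simpa [Fintype.linearCombination_apply_single, Pi.single_apply, eq_comm] using this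
    have hv := h1 0
    have hw := h1 1
    have h2 : ∀ z : Fin 4 → K, g z t = ∑ k, z k * g (fun j => if k = j then 1 else 0) t := by
      intro z
      conv_lhs => rw [LinearMap.pi_apply_eq_sum_univ g z]
      simp
    rw [h2] at hv hw
    have h3 : MvPolynomial.X (R := K) t = ∑ k, g (fun j => if k = j then 1 else 0) t • genericPencil v w k := by
      simp only [genericPencil, smul_add, smul_smul, Finset.sum_add_distrib, ← Finset.sum_smul]
      simp only [Matrix.cons_val_zero, Matrix.cons_val_one, mul_comm (v _), mul_comm (w _)] at hv hw
      rw [hv, hw]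
      fin_cases t <;> simp
    rw [h3]
    exact IsIntegral.sum _ fun k _ => IsIntegral.smul _ (isIntegral_charInvariants_diagonal _ k)
  have hint : Algebra.IsIntegral θ.range (MvPolynomial (Fin 2) K) := by
    refine ⟨fun F => ?_⟩
    induction F using MvPolynomial.induction_on with
    | C c => exact isIntegral_algebraMap (x := (algebraMap K θ.range c))
    | add p q hp hq => exact hp.add hq
    | mul_X p t hp => exact hp.mul (hX t)
  have htr : Algebra.trdeg K θ.range = 2 := by
    have := trdeg_add_eq K θ.range (A := MvPolynomial (Fin 2) K)
    rw [trdeg_eq_zero (R := θ.range), add_zero, MvPolynomial.trdeg_of_isDomain] at this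
    simpa using this
  obtain ⟨ι, x, hx⟩ := exists_isTranscendenceBasis' K θ.range
  have hcard := hx.cardinalMk_eq_trdeg
  rw [htr] at hcard
  obtain ⟨e⟩ : Nonempty (Fin 2 ≃ ι) := by
    rw [← Cardinal.lift_mk_eq', hcard]
    simp
  choose f hf using fun t => (x (e t)).2
  refine ⟨f, ?_⟩
  have h1 := (hx.1.comp e e.injective).map' (f := θ.range.val) Subtype.val_injective
  convert! h1 using 2 with t
  exact hf t

/-- If no three polynomials in the characteristic coefficients `s` are algebraically independent,
and those of a pencil are a specialization of `s`, then the pencil satisfies no further relations. -/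
theorem aeval_eq_zero_of_aeval_pencil_eq_zero [IsDomain L] (h : LinearIndependent K ![v, w])
    {s : Fin 4 → L}
    (hs : ∀ F : MvPolynomial (Fin 4) K, MvPolynomial.aeval s F = 0 →
      MvPolynomial.aeval (charInvariants (Matrix.diagonal (genericPencil v w))) F = 0)
    (h3 : ∀ f : Option (Fin 2) → MvPolynomial (Fin 4) K,
      ¬ AlgebraicIndependent K fun t => MvPolynomial.aeval s (f t))
    {F : MvPolynomial (Fin 4) K}
    (hF : MvPolynomial.aeval (charInvariants (Matrix.diagonal (genericPencil v w))) F = 0) :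
    MvPolynomial.aeval s F = 0 := by
  set θ := MvPolynomial.aeval (R := K) (charInvariants (Matrix.diagonal (genericPencil v w))) with hθ
  set ψ := MvPolynomial.aeval (R := K) s with hψ
  have : (RingHom.ker ψ).IsPrime := RingHom.ker_isPrime _
  -- The specialization from the algebra generated by `s` to the pencil keeps two elements
  -- independent, while its source has no three; so it is injective.
  let φ : (MvPolynomial (Fin 4) K ⧸ RingHom.ker ψ) →ₐ[K] MvPolynomial (Fin 2) K :=
    Ideal.Quotient.liftₐ (RingHom.ker ψ) θ hs
  obtain ⟨f, hf⟩ := exists_algebraicIndependent_pencil h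
  refine RingHom.mem_ker.mp (Ideal.Quotient.eq_zero_iff_mem.mp ?_)
  refine eq_zero_of_map_eq_zero_of_not_algebraicIndependent φ
    (x := fun t => Ideal.Quotient.mk _ (f t)) hf (fun y hy => ?_) hF
  choose g hg using fun t => Ideal.Quotient.mk_surjective (y t)
  apply h3 g
  have h1 := hy.map' (f := Ideal.kerLiftAlg ψ) (Ideal.kerLiftAlg_injective ψ)
  convert! h1 using 2 with t
  simp [← hg, hψ]

theorem aeval_charInvariants_diagonal {F N : MvPolynomial (Fin 4) K}
    (h : MvPolynomial.aeval (fun k : Fin 4 => MvPolynomial.esymm (Fin 4) K (k + 1)) F = N)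
    (y : Fin 4 → L) :
    MvPolynomial.aeval (charInvariants (Matrix.diagonal y)) F = MvPolynomial.aeval y N := by
  rw [← h, MvPolynomial.comp_aeval_apply, ← charInvariants_diagonal]

/-- A point whose characteristic coefficients satisfy all relations of a pencil is a permutation
of a point of the span of the pencil. -/
theorem exists_perm_forall_sum_eq_zero [Infinite K] [IsDomain L] {z : Fin 4 → L}
    (hz : ∀ F : MvPolynomial (Fin 4) K,
      MvPolynomial.aeval (charInvariants (Matrix.diagonal (genericPencil v w))) F = 0 →
        MvPolynomial.aeval (charInvariants (Matrix.diagonal z)) F = 0) :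
    ∃ σ : Equiv.Perm (Fin 4), ∀ l : Fin 4 → K, ∑ k, l k * v k = 0 → ∑ k, l k * w k = 0 →
      ∑ k, l k • z (σ k) = 0 := by
  -- For a single linear form vanishing on the pencil, the product of its 24 permuted copies is
  -- symmetric, hence a polynomial in the invariants. It vanishes on the pencil, so it vanishes at
  -- `z`, and then some factor does.
  have key : ∀ l : Fin 4 → K, ∑ k, l k * v k = 0 → ∑ k, l k * w k = 0 →
      ∃ σ : Equiv.Perm (Fin 4), ∑ k, l k • z (σ k) = 0 := by
    intro l hv hw
    let N : MvPolynomial (Fin 4) K := ∏ σ : Equiv.Perm (Fin 4), ∑ k, l k • MvPolynomial.X (σ k)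
    have hN : N.IsSymmetric := by
      intro τ
      simp only [N, map_prod, map_sum, map_smul, MvPolynomial.rename_X]
      exact Fintype.prod_equiv (Equiv.mulLeft τ) _ _ fun σ => rfl
    obtain ⟨F, hF⟩ := MvPolynomial.esymmAlgHom_surjective (σ := Fin 4) (R := K) (n := 4) (by simp)
      ⟨N, hN⟩
    have hF' : MvPolynomial.aeval (fun k : Fin 4 => MvPolynomial.esymm (Fin 4) K (k + 1)) F = N := by
      rw [← MvPolynomial.esymmAlgHom_apply, hF]
    have h0 := hz F (by
      rw [aeval_charInvariants_diagonal hF']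
      simp only [N, map_prod, map_sum, map_smul, MvPolynomial.aeval_X]
      refine Finset.prod_eq_zero (Finset.mem_univ 1) ?_
      simp only [genericPencil, Equiv.Perm.one_apply, smul_add, smul_smul, Finset.sum_add_distrib,
        ← Finset.sum_smul, hv, hw, zero_smul, add_zero])
    rw [aeval_charInvariants_diagonal hF'] at h0
    simp only [N, map_prod, map_sum, map_smul, MvPolynomial.aeval_X, Finset.prod_eq_zero_iff] at h0
    obtain ⟨σ, -, hσ⟩ := h0
    exact ⟨σ, hσ⟩
  by_contra! hcon
  -- So far the permutation depends on `l`. The forms served by a given permutation are a subspace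
  -- of the annihilator `E`, and over an infinite field finitely many proper subspaces cannot cover
  -- `E`.
  let E : Submodule K (Fin 4 → K) :=
    LinearMap.ker (Fintype.linearCombination K v) ⊓ LinearMap.ker (Fintype.linearCombination K w)
  let T : Equiv.Perm (Fin 4) → Submodule K E := fun σ =>
    LinearMap.ker ((Fintype.linearCombination K fun k => z (σ k)).comp E.subtype)
  have hmem : ∀ l : Fin 4 → K, l ∈ E ↔ ∑ k, l k * v k = 0 ∧ ∑ k, l k * w k = 0 := by
    intro l
    simp [E, Fintype.linearCombination_apply]
  refine Subspace.biUnion_ne_univ_of_top_notMem (s := Finset.univ.image T) ?_ ?_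
  · simp only [Finset.mem_image, Finset.mem_univ, true_and, not_exists]
    intro σ hσ
    obtain ⟨l, hv, hw, hne⟩ := hcon σ
    have : (⟨l, (hmem l).mpr ⟨hv, hw⟩⟩ : E) ∈ T σ := hσ ▸ Submodule.mem_top
    apply hne
    simpa [T, Fintype.linearCombination_apply] using this
  · rw [Set.eq_univ_iff_forall]
    rintro ⟨l, hl⟩
    obtain ⟨hv, hw⟩ := (hmem l).mp hl
    obtain ⟨σ, hσ⟩ := key l hv hw
    simp only [Set.mem_iUnion]
    exact ⟨T σ, Finset.mem_image_of_mem _ (Finset.mem_univ _), by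
      simpa [T, Fintype.linearCombination_apply] using hσ⟩

end Pencil

/-! ### The plane of a translated family of diagonal values -/

section Plane

variable {K : Type*} [Field K] [Infinite K] {m : ℕ} {p : FreeAlgebra K (Fin m)}
  {G : Type*} [AddCommGroup G] [Fintype G] [DecidableEq G] {φ : Fin 4 ≃ G} {i j : Fin m → Fin 4}

/-- Otherwise a linear functional would separate `z` from the span. -/
theorem mem_span_pair_of_forall_sum_eq_zero {v w z : Fin 4 → K}
    (h : ∀ l : Fin 4 → K, ∑ k, l k * v k = 0 → ∑ k, l k * w k = 0 → ∑ k, l k * z k = 0) :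
    z ∈ Submodule.span K {v, w} := by
  by_contra hz
  obtain ⟨f, hf, hf0⟩ := Submodule.exists_dual_map_eq_bot_of_notMem hz inferInstance
  have hsum : ∀ y : Fin 4 → K, ∑ k, f (fun t => if k = t then 1 else 0) * y k = f y := by
    intro y
    rw [LinearMap.pi_apply_eq_sum_univ f y]
    simp [mul_comm]
  have h0 : ∀ y ∈ Submodule.span K {v, w}, f y = 0 := by
    intro y hy
    have := Submodule.mem_map_of_mem (f := f) hy
    rwa [hf0, Submodule.mem_bot] at this
  apply hf
  rw [← hsum]
  exact h _ ((hsum v).trans (h0 v (Submodule.subset_span (by simp))))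
    ((hsum w).trans (h0 w (Submodule.subset_span (by simp))))

variable {L : Type*} [CommRing L] [Algebra K L]

theorem IsMultilinearPoly.translateValue_eq_diagonal (hp : IsMultilinearPoly p)
    (hd : ∑ k, (φ (j k) - φ (i k)) = 0) (u : Fin m → G → L) :
    translateValue p φ i j u = Matrix.diagonal fun a => translateValue p φ i j u a a := by
  ext a b
  by_cases h : a = b
  · simp [h]
  · rw [Matrix.diagonal_apply_ne _ h]
    by_contra h0
    have := hp.translateValue_isWeightHomogeneous u a b h0
    rw [hd, sub_eq_zero] at this
    exact h (φ.injective this).symm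

theorem translateValue_indexTranslate (u : Fin m → G → L) (h : G) (a b : Fin 4) :
    translateValue p φ i j u (indexTranslate φ h a) (indexTranslate φ h b) =
      translateValue p φ i j (fun k g => u k (g + h)) a b := by
  rw [← translateValue_translate (fun k g => u k (g + h)) h]
  simp

/-- The diagonal of `translateValue`. -/
def translateDiag (p : FreeAlgebra K (Fin m)) (φ : Fin 4 ≃ G) (i j : Fin m → Fin 4)
    (u : Fin m → G → L) (x : Fin 4) : L :=
  translateValue p φ i j u x x

theorem translateDiag_indexTranslate (u : Fin m → G → L) (h : G) :
    (fun x => translateDiag p φ i j u (indexTranslate φ h x)) =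
      translateDiag p φ i j fun k g => u k (g + h) :=
  funext fun x => translateValue_indexTranslate u h x x

/-- Two linearly independent diagonal values span a plane; if no three characteristic coefficients
of the generic value are algebraically independent, this plane determines all relations between
them, and contains all values of the family. -/
theorem IsMultilinearPoly.exists_plane (hp : IsMultilinearPoly p)
    (hd : ∑ k, (φ (j k) - φ (i k)) = 0) {a b : Fin m → G → K}
    (hab : LinearIndependent K ![translateDiag p φ i j a, translateDiag p φ i j b]) :
    ∃ u₁ u₂ : Fin m → G → K, ∃ v w, v = translateDiag p φ i j u₁ ∧ w = translateDiag p φ i j u₂ ∧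
      LinearIndependent K ![v, w] ∧
      (∀ F : MvPolynomial (Fin 4) K, MvPolynomial.aeval (charInvariants (genericValue p)) F = 0 →
        MvPolynomial.aeval (charInvariants (Matrix.diagonal (genericPencil v w))) F = 0) ∧
      ((∀ f : Option (Fin 2) → MvPolynomial (Fin 4) K, ¬ AlgebraicIndependent K fun t =>
          MvPolynomial.aeval (charInvariants (genericValue p)) (f t)) →
        (∀ F : MvPolynomial (Fin 4) K,
          MvPolynomial.aeval (charInvariants (Matrix.diagonal (genericPencil v w))) F = 0 →
            MvPolynomial.aeval (charInvariants (genericValue p)) F = 0) ∧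
        ∀ u : Fin m → G → K, translateDiag p φ i j u ∈ Submodule.span K {v, w}) := by
  obtain ⟨f, hf⟩ := hp.exists_multilinearMap_translateValue (L := K) (φ := φ) (i := i) (j := j)
  let D := (Matrix.diagLinearMap (Fin 4) K K).compMultilinearMap f
  have hD : ∀ u, D u = translateDiag p φ i j u := by
    intro u
    funext x
    simp [D, hf, translateDiag]
  simp only [← hD] at hab ⊢
  -- Since the arguments differ in one slot only, every combination of the two values is again a
  -- value of the family.
  obtain ⟨u, s, y, hind⟩ := D.exists_linearIndependent_update hab
  have hspec : ∀ F : MvPolynomial (Fin 4) K,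
      MvPolynomial.aeval (charInvariants (genericValue p)) F = 0 →
      MvPolynomial.aeval (charInvariants (Matrix.diagonal
        (genericPencil (D u) (D (Function.update u s y))))) F = 0 := by
    intro F hF
    refine MvPolynomial.funext fun t => ?_
    rw [map_zero]
    change MvPolynomial.aeval t _ = 0
    rw [MvPolynomial.comp_aeval_apply]
    have h1 := aeval_charInvariants_ncEval hF fun k => translateComb φ (i k) (j k)
      (Function.update u s (t 0 • u s + t 1 • y) k)
    change MvPolynomial.aeval (charInvariants (translateValue p φ i j _)) F = 0 at h1
    rw [hp.translateValue_eq_diagonal hd] at h1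
    change MvPolynomial.aeval (charInvariants (Matrix.diagonal (translateDiag p φ i j _))) F = 0 at h1
    rw [← hD] at h1
    rw [← h1]
    refine congrArg (fun z => MvPolynomial.aeval z F) ?_
    refine (charInvariants_map (MvPolynomial.aeval (R := K) t).toRingHom _).symm.trans ?_
    congr 1
    ext a b
    by_cases hab : a = b
    · subst hab
      simp [genericPencil, mul_comm]
    · simp [hab]
  refine ⟨u, Function.update u s y, D u, D (Function.update u s y), rfl, rfl, hind, hspec, fun h3 => ?_⟩
  have hker : ∀ F : MvPolynomial (Fin 4) K, _ → _ := fun F =>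
    aeval_eq_zero_of_aeval_pencil_eq_zero hind hspec h3 (F := F)
  refine ⟨hker, ?_⟩
  -- Applied to the generic member of the family, this gives one permutation `σ` that works for all
  -- members.
  obtain ⟨σ, hσ⟩ := exists_perm_forall_sum_eq_zero
    (z := fun x => genericTranslateValue p φ i j x x) fun F hF => by
      have := aeval_charInvariants_ncEval (hker F hF) fun k => translateComb φ (i k) (j k)
        fun g => MvPolynomial.X (R := K) (k, g)
      change MvPolynomial.aeval (charInvariants (translateValue p φ i j _)) F = 0 at this
      rw [hp.translateValue_eq_diagonal hd] at this
      exact this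
  set v := D u
  set w := D (Function.update u s y)
  have hmem : ∀ u', (fun x => D u' (σ x)) ∈ Submodule.span K {v, w} := by
    intro u'
    refine mem_span_pair_of_forall_sum_eq_zero fun l hv hw => ?_
    have h1 := congrArg (MvPolynomial.aeval fun kg : Fin m × G => u' kg.1 kg.2) (hσ l hv hw)
    simp only [map_sum, map_smul, map_zero, aeval_genericTranslateValue] at h1
    simpa [hD, translateDiag] using h1
  let e := LinearEquiv.funCongrLeft K K σ
  have hfin : Module.finrank K (Submodule.span K {v, w}) = 2 := by
    have hr : Set.range ![v, w] = {v, w} := by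
      ext z
      simp [or_comm]
    rw [← hr, finrank_span_eq_card hind, Fintype.card_fin]
  have hle : (Submodule.span K {v, w}).map (e : (Fin 4 → K) →ₗ[K] (Fin 4 → K)) ≤
      Submodule.span K {v, w} := by
    rw [Submodule.map_span_le]
    rintro z (rfl | rfl)
    · exact hmem _
    · exact hmem _
  -- The spanning vectors are members of the family, so `σ` maps the plane into itself, hence onto
  -- itself, and can be undone.
  have heq := Submodule.eq_of_le_of_finrank_eq hle (LinearEquiv.finrank_map_eq e _)
  intro u'
  have h1 := hmem u'
  rw [← heq] at h1
  obtain ⟨z, hz, hzu⟩ := h1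
  have : z = D u' := e.injective hzu
  rwa [← this]

end Plane

/-! ### Antisymmetric spectra -/

section Antisymmetric

variable {K : Type*} [Field K] {L : Type*} [CommRing L]

theorem charInvariants_diagonal_zero (z : Fin 4 → L) :
    charInvariants (Matrix.diagonal z) 0 = z 0 + z 1 + z 2 + z 3 := by
  rw [charInvariants_diagonal (K := ℤ)]
  have : Finset.powersetCard 1 (Finset.univ : Finset (Fin 4)) = {{0}, {1}, {2}, {3}} := by decide
  simp [MvPolynomial.esymm, this]
  ring

theorem charInvariants_diagonal_two (z : Fin 4 → L) :
    charInvariants (Matrix.diagonal z) 2 =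
      z 0 * z 1 * z 2 + z 0 * z 1 * z 3 + z 0 * z 2 * z 3 + z 1 * z 2 * z 3 := by
  rw [charInvariants_diagonal (K := ℤ)]
  have : Finset.powersetCard 3 (Finset.univ : Finset (Fin 4)) =
      {{0, 1, 2}, {0, 1, 3}, {0, 2, 3}, {1, 2, 3}} := by decide
  simp [MvPolynomial.esymm, this]
  rw [Finset.sum_insert (by decide), Finset.sum_insert (by decide), Finset.sum_insert (by decide)]
  simp
  ring

theorem charInvariants_submatrix (M : Matrix (Fin 4) (Fin 4) L) (ρ : Equiv.Perm (Fin 4)) :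
    charInvariants (M.submatrix ρ ρ) = charInvariants M := by
  ext k
  have := Matrix.charpoly_reindex ρ.symm M
  rw [charInvariants, charInvariants, ← this]
  rfl

/-- The odd characteristic coefficients of an antisymmetric spectrum vanish. -/
theorem charInvariants_eq_zero_of_comp_eq_neg [IsDomain L] (h2 : (2 : L) ≠ 0) {z : Fin 4 → L}
    {ρ : Equiv.Perm (Fin 4)} (h : ∀ k, z (ρ k) = - z k) :
    charInvariants (Matrix.diagonal z) 0 = 0 ∧ charInvariants (Matrix.diagonal z) 2 = 0 := by
  -- Negation only permutes the spectrum, so the symmetric functions of odd degree equal their own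
  -- negatives.
  have h1 : charInvariants (Matrix.diagonal fun k => - z k) = charInvariants (Matrix.diagonal z) := by
    rw [← charInvariants_submatrix (Matrix.diagonal z) ρ, Matrix.submatrix_diagonal_equiv]
    congr 2
    exact funext fun k => (h k).symm
  have h3 := congrFun h1 0
  have h4 := congrFun h1 2
  rw [charInvariants_diagonal_zero, charInvariants_diagonal_zero] at h3
  rw [charInvariants_diagonal_two, charInvariants_diagonal_two] at h4
  rw [charInvariants_diagonal_zero, charInvariants_diagonal_two]
  constructor
  · refine (mul_eq_zero.mp (?_ : (2 : L) * _ = 0)).resolve_left h2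
    linear_combination -h3
  · refine (mul_eq_zero.mp (?_ : (2 : L) * _ = 0)).resolve_left h2
    linear_combination -h4

variable {F : Type*} [Field F] [Algebra K F] {v w : Fin 4 → K}

theorem exists_eq_smul_add_smul_of_forall_sum_eq_zero (h : LinearIndependent K ![v, w])
    {d : Fin 4 → F}
    (hd : ∀ l : Fin 4 → K, ∑ k, l k * v k = 0 → ∑ k, l k * w k = 0 → ∑ k, l k • d k = 0) :
    ∃ α β : F, ∀ k, d k = v k • α + w k • β := by
  obtain ⟨g, hg⟩ := LinearMap.exists_leftInverse_of_injective (Fintype.linearCombination K ![v, w])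
    (LinearMap.ker_eq_bot.mpr (linearIndependent_iff_injective_fintypeLinearCombination.mp h))
  have h1 : ∀ s t : Fin 2, g (![v, w] s) t = if s = t then 1 else 0 := by
    intro s t
    have := congrFun (LinearMap.congr_fun hg (Pi.single s 1)) t
    simpa [Fintype.linearCombination_apply_single, Pi.single_apply, eq_comm] using this
  have hv : ∀ t, g v t = if 0 = t then 1 else 0 := h1 0
  have hw : ∀ t, g w t = if 1 = t then 1 else 0 := h1 1
  have h2 : ∀ (z : Fin 4 → K) t, g z t = ∑ k, g (fun j => if k = j then 1 else 0) t * z k := by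
    intro z t
    conv_lhs => rw [LinearMap.pi_apply_eq_sum_univ g z]
    simp [mul_comm]
  refine ⟨∑ k, g (fun j => if k = j then 1 else 0) 0 • d k,
    ∑ k, g (fun j => if k = j then 1 else 0) 1 • d k, fun k => ?_⟩
  -- The `k`-th coordinate form minus the `k`-th coordinate of a projection onto the plane; it
  -- annihilates `v` and `w`.
  have h3 := hd (fun t => (if t = k then 1 else 0) - (v k * g (fun j => if t = j then 1 else 0) 0 +
    w k * g (fun j => if t = j then 1 else 0) 1)) ?_ ?_
  · simp only [sub_smul, add_smul, mul_smul, Finset.sum_sub_distrib, Finset.sum_add_distrib,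
      ← Finset.smul_sum, ite_smul, one_smul, zero_smul, Finset.sum_ite_eq', Finset.mem_univ,
      if_true, sub_eq_zero] at h3
    exact h3
  · simp only [sub_mul, add_mul, mul_assoc, Finset.sum_sub_distrib, Finset.sum_add_distrib,
      ← Finset.mul_sum, ← h2]
    simp [hv]
  · simp only [sub_mul, add_mul, mul_assoc, Finset.sum_sub_distrib, Finset.sum_add_distrib,
      ← Finset.mul_sum, ← h2]
    simp [hw]

/-- If two independent vectors of the (extended) plane spanned by `v` and `w` are antisymmetric,
then so are `v` and `w`. -/
theorem comp_eq_neg_of_linearIndependent {ρ : Fin 4 → Fin 4} {d d' : Fin 4 → F}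
    (hd : ∃ α β : F, ∀ k, d k = v k • α + w k • β) (hd' : ∃ α β : F, ∀ k, d' k = v k • α + w k • β)
    (h : LinearIndependent F ![d, d']) (hρ : ∀ k, d (ρ k) = - d k) (hρ' : ∀ k, d' (ρ k) = - d' k) :
    (∀ k, v (ρ k) = - v k) ∧ ∀ k, w (ρ k) = - w k := by
  obtain ⟨α, β, hd⟩ := hd
  obtain ⟨α', β', hd'⟩ := hd'
  simp only [Algebra.smul_def] at hd hd'
  rw [LinearIndependent.pair_iff] at h
  -- The determinant of the passage from `v, w` to `d, d'`; once it is nonzero, Cramer's rule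
  -- expresses `v` and `w` through `d` and `d'`.
  have hΔ : α * β' - α' * β ≠ 0 := by
    intro h0
    obtain ⟨hβ', hβ⟩ := h β' (-β) (by
      ext k; simp [hd, hd']; linear_combination algebraMap K F (v k) * h0)
    obtain ⟨hα', hα⟩ := h α' (-α) (by
      ext k; simp [hd, hd']; linear_combination -algebraMap K F (w k) * h0)
    have := (h 1 0 (by ext k; simp [hd, neg_eq_zero.mp hα, neg_eq_zero.mp hβ])).1
    exact one_ne_zero this
  have hinj := (algebraMap K F).injective
  constructor
  · intro k
    apply hinj
    apply mul_left_cancel₀ hΔ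
    have h1 := hρ k
    have h2 := hρ' k
    simp only [hd, hd'] at h1 h2
    rw [map_neg]
    linear_combination β' * h1 - β * h2
  · intro k
    apply hinj
    apply mul_left_cancel₀ hΔ
    have h1 := hρ k
    have h2 := hρ' k
    simp only [hd, hd'] at h1 h2
    rw [map_neg]
    linear_combination -α' * h1 + α * h2

end Antisymmetric

/-! ### Existence of an antisymmetric plane -/

section Cases

variable {K : Type*} [Field K] [Infinite K] {m : ℕ} {p : FreeAlgebra K (Fin m)}
  {G : Type*} [AddCommGroup G] [Fintype G] [DecidableEq G] {φ : Fin 4 ≃ G} {i j : Fin m → Fin 4}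

/-- The vectors `v`, `w` span a plane of spectra of values of `p`; if no three characteristic
coefficients of the generic value are algebraically independent, all relations of the spectra in
this plane hold for the generic value, and the plane is antisymmetric. -/
def IsSpectralPlane (p : FreeAlgebra K (Fin m)) (v w : Fin 4 → K) : Prop :=
  LinearIndependent K ![v, w] ∧
  (∀ F : MvPolynomial (Fin 4) K, MvPolynomial.aeval (charInvariants (genericValue p)) F = 0 →
    MvPolynomial.aeval (charInvariants (Matrix.diagonal (genericPencil v w))) F = 0) ∧
  ((∀ f : Option (Fin 2) → MvPolynomial (Fin 4) K, ¬ AlgebraicIndependent K fun t =>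
      MvPolynomial.aeval (charInvariants (genericValue p)) (f t)) →
    (∀ F : MvPolynomial (Fin 4) K,
      MvPolynomial.aeval (charInvariants (Matrix.diagonal (genericPencil v w))) F = 0 →
        MvPolynomial.aeval (charInvariants (genericValue p)) F = 0) ∧
    ∃ ρ : Equiv.Perm (Fin 4), (∀ k, v (ρ k) = - v k) ∧ ∀ k, w (ρ k) = - w k)

theorem translateDiag_pi_single :
    translateDiag p φ i j (fun _ => (Pi.single 0 1 : G → K)) =
      fun x => (ncEval p fun k => Matrix.single (i k) (j k) (1 : K)) x x := by
  funext x
  rw [translateDiag, translateValue_pi_single]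

theorem IsMultilinearPoly.sum_sub_eq_zero (hp : IsMultilinearPoly p) {x : Fin 4}
    (hx : (ncEval p fun k => Matrix.single (i k) (j k) (1 : K)) x x ≠ 0) (φ : Fin 4 ≃ G) :
    ∑ k, (φ (j k) - φ (i k)) = 0 := by
  rw [← translateValue_pi_single (φ := φ)] at hx
  rw [← hp.translateValue_isWeightHomogeneous _ x x hx, sub_self]

theorem charpoly_cyclic {L : Type*} [CommRing L] (c : Fin 4 → L) :
    (!![0, c 0, 0, 0; 0, 0, c 1, 0; 0, 0, 0, c 2; c 3, 0, 0, 0]).charpoly =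
      Polynomial.X ^ 4 - Polynomial.C (c 0 * c 1 * c 2 * c 3) := by
  simp [Matrix.charpoly, Matrix.charmatrix, Matrix.det_succ_row_zero, Fin.sum_univ_succ,
    Fin.succAbove]
  ring

theorem charpoly_fourth_roots {L : Type*} [CommRing L] {r ε : L} (hε : ε ^ 2 = -1) :
    (Matrix.diagonal ![r, ε * r, -r, -(ε * r)]).charpoly = Polynomial.X ^ 4 -
      Polynomial.C (r ^ 4) := by
  have : Polynomial.C ε ^ 2 = -1 := by rw [← map_pow, hε]; simp
  rw [Matrix.charpoly_diagonal, Fin.prod_univ_four]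
  simp only [Matrix.cons_val, map_neg, map_mul, map_pow]
  linear_combination (Polynomial.C r ^ 4 - Polynomial.C r ^ 2 * Polynomial.X ^ 2) * this

/-- The values of `p` include a matrix with eigenvalues `r, ε r, -r, -ε r`, where `ε² = -1`. -/
theorem IsMultilinearPoly.exists_fourth_roots (hp : IsMultilinearPoly p)
    (hPI : ¬ IsPIOf p (Matrix (Fin 4) (Fin 4) K))
    (hcentral : ¬ IsCentralPolyOf p (Matrix (Fin 4) (Fin 4) K)) :
    ∃ r ε : AlgebraicClosure K, r ≠ 0 ∧ ε ^ 2 = -1 ∧ ∀ F : MvPolynomial (Fin 4) K,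
      MvPolynomial.aeval (charInvariants (genericValue p)) F = 0 →
        MvPolynomial.aeval (charInvariants (Matrix.diagonal ![r, ε * r, -r, -(ε * r)])) F = 0 := by
  obtain ⟨c, hc, a, ha⟩ := hp.exists_cyclic_mem_imageOf hPI hcentral
  -- The 4-cycle value has characteristic polynomial `X⁴ - c₀c₁c₂c₃`, so its eigenvalues are fourth
  -- roots.
  obtain ⟨r, hr⟩ := IsAlgClosed.exists_pow_nat_eq
    (algebraMap K (AlgebraicClosure K) (c 0 * c 1 * c 2 * c 3)) (n := 4) (by norm_num)
  obtain ⟨ε, hε⟩ := IsAlgClosed.exists_pow_nat_eq (-1 : AlgebraicClosure K) (n := 2) (by norm_num)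
  refine ⟨r, ε, ?_, hε, fun F hF => ?_⟩
  · rintro rfl
    rw [zero_pow (by norm_num)] at hr
    simpa [hc] using hr.symm
  have h1 := congrArg (Algebra.ofId K (AlgebraicClosure K)) (aeval_charInvariants_ncEval hF a)
  rw [ha, MvPolynomial.comp_aeval_apply, map_zero] at h1
  rw [← h1]
  refine congrArg (fun z => MvPolynomial.aeval z F) (funext fun k => ?_)
  rw [charInvariants, charInvariants, charpoly_cyclic, charpoly_fourth_roots hε, hr]
  generalize c 0 * c 1 * c 2 * c 3 = e
  have h2 : (Polynomial.X ^ 4 - Polynomial.C e).map (algebraMap K (AlgebraicClosure K)) =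
      Polynomial.X ^ 4 - Polynomial.C (algebraMap K (AlgebraicClosure K) e) := by simp
  rw [← h2, Polynomial.coeff_map, Algebra.ofId_apply, map_mul]
  simp

/-- A diagonal value `(x, x, -x, -x)` and its translate by a 4-cycle give a spectral plane. -/
theorem IsMultilinearPoly.isSpectralPlane_of_cyclic (hp : IsMultilinearPoly p)
    (h2 : (2 : K) ≠ 0) {x : K} (hx : x ≠ 0) (φ : Fin 4 ≃ ZMod 4)
    (hD : ∀ g, (ncEval p fun k => Matrix.single (i k) (j k) (1 : K)) (φ.symm g) (φ.symm g) =
      if g = 0 ∨ g = 1 then x else -x) : ∃ v w : Fin 4 → K, IsSpectralPlane p v w := by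
  have hd := hp.sum_sub_eq_zero (x := φ.symm 0) (by rw [hD]; simpa using hx) φ
  set D := translateDiag p φ i j (fun _ => (Pi.single 0 1 : ZMod 4 → K)) with hDdef
  set D' := translateDiag p φ i j (fun _ g => (Pi.single 0 1 : ZMod 4 → K) (g + 1)) with hD'def
  have hDv : ∀ k, D k = if φ k = 0 ∨ φ k = 1 then x else -x := by
    intro k
    rw [← hD (φ k), hDdef, translateDiag_pi_single]
    simp
  have hD' : ∀ k, D' k = D (indexTranslate φ 1 k) := by
    intro k
    exact (congrFun (translateDiag_indexTranslate _ 1) k).symm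
  -- The half turn negates `D`. It commutes with the quarter turn, so it negates `D'` too.
  have hanti : ∀ k, D (indexTranslate φ 2 k) = - D k := by
    intro k
    rw [hDv, hDv, apply_indexTranslate]
    generalize φ k = g
    have h : ∀ g : ZMod 4, (g + 2 = 0 ∨ g + 2 = 1) ↔ ¬ (g = 0 ∨ g = 1) := by decide
    by_cases hg : g = 0 ∨ g = 1
    · rw [if_neg ((h g).not_left.mpr hg), if_pos hg]
    · rw [if_pos ((h g).mpr hg), if_neg hg, neg_neg]
  have hind : LinearIndependent K ![D, D'] := by
    rw [LinearIndependent.pair_iff]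
    intro s t hst
    have h0 := congrFun hst (φ.symm 0)
    have h1 := congrFun hst (φ.symm 1)
    simp only [Pi.add_apply, Pi.smul_apply, hD', hDv, apply_indexTranslate, Equiv.apply_symm_apply,
      Pi.zero_apply, smul_eq_mul] at h0 h1
    rw [if_pos (by decide), if_pos (by decide)] at h0
    rw [if_pos (by decide), if_neg (by decide)] at h1
    have hs : 2 * (s * x) = 0 := by linear_combination h0 + h1
    have ht : 2 * (t * x) = 0 := by linear_combination h0 - h1
    simpa [h2, hx] using And.intro hs ht
  obtain ⟨-, -, v, w, -, -, hvw, h3, h4⟩ := hp.exists_plane hd hind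
  refine ⟨v, w, hvw, h3, fun h => ⟨(h4 h).1, indexTranslate φ 2, ?_⟩⟩
  have hmem : ∀ u, ∃ α β : K, ∀ k, translateDiag p φ i j u k = v k • α + w k • β := by
    intro u
    obtain ⟨α, β, hαβ⟩ := Submodule.mem_span_pair.mp ((h4 h).2 u)
    exact ⟨α, β, fun k => by rw [← hαβ]; simp [mul_comm]⟩
  refine comp_eq_neg_of_linearIndependent (hmem _) (hmem _) hind hanti fun k => ?_
  rw [← hD'def, hD', hD', ← hanti, ← indexTranslate_add, ← indexTranslate_add, add_comm]

/-- The identification of the index set with the Klein four-group. -/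
def kleinEquiv : Fin 4 ≃ ZMod 2 × ZMod 2 :=
  (finProdFinEquiv (m := 2) (n := 2)).symm

/-- The Klein four-group is normal in the symmetric group. -/
theorem exists_indexTranslate_kleinEquiv_conj (σ : Equiv.Perm (Fin 4)) (g : ZMod 2 × ZMod 2) :
    ∃ g' : ZMod 2 × ZMod 2, ∀ k,
      σ (indexTranslate kleinEquiv g' k) = indexTranslate kleinEquiv g (σ k) := by
  decide +revert

/-- A diagonal value that is independent of one of its translates by the Klein four-group gives a
spectral plane. -/
theorem IsMultilinearPoly.isSpectralPlane_of_klein (hp : IsMultilinearPoly p)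
    (hPI : ¬ IsPIOf p (Matrix (Fin 4) (Fin 4) K))
    (hcentral : ¬ IsCentralPolyOf p (Matrix (Fin 4) (Fin 4) K)) (h2 : (2 : K) ≠ 0)
    {D : Fin 4 → K} (hD : ∀ k, (ncEval p fun k => Matrix.single (i k) (j k) (1 : K)) k k = D k)
    {h : ZMod 2 × ZMod 2}
    (hind : LinearIndependent K ![D, fun k => D (indexTranslate kleinEquiv h k)]) :
    ∃ v w : Fin 4 → K, IsSpectralPlane p v w := by
  have hD1 : D = translateDiag p kleinEquiv i j
      (fun _ => (Pi.single 0 1 : ZMod 2 × ZMod 2 → K)) := by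
    rw [translateDiag_pi_single]
    exact funext fun k => (hD k).symm
  obtain ⟨x, hx⟩ := Function.ne_iff.mp (hind.ne_zero 0)
  have hd := hp.sum_sub_eq_zero (x := x) (by rw [hD]; exact hx) kleinEquiv
  rw [hD1, translateDiag_indexTranslate] at hind
  obtain ⟨u₁, u₂, v, w, hv, hw, hvw, h3, h4⟩ := hp.exists_plane hd hind
  refine ⟨v, w, hvw, h3, fun hno => ⟨(h4 hno).1, ?_⟩⟩
  obtain ⟨r, ε, hr, hε, hq⟩ := hp.exists_fourth_roots hPI hcentral
  set q : Fin 4 → AlgebraicClosure K := ![r, ε * r, -r, -(ε * r)] with hqdef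
  -- Up to `σ`, the spectrum of fourth roots lies in the plane extended to the algebraic closure.
  obtain ⟨σ, hσ⟩ := exists_perm_forall_sum_eq_zero (z := q) fun F hF => hq F ((h4 hno).1 F hF)
  have hinv : ∀ u : Fin m → ZMod 2 × ZMod 2 → K, ∀ (g : ZMod 2 × ZMod 2) (l : Fin 4 → K),
      ∑ k, l k * v k = 0 → ∑ k, l k * w k = 0 →
        ∑ k, l k * translateDiag p kleinEquiv i j u (indexTranslate kleinEquiv g k) = 0 := by
    intro u g l hlv hlw
    obtain ⟨α, β, hαβ⟩ := Submodule.mem_span_pair.mp ((h4 hno).2 fun k g' => u k (g' + g))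
    rw [← translateDiag_indexTranslate u g] at hαβ
    have : ∀ k, translateDiag p kleinEquiv i j u (indexTranslate kleinEquiv g k) =
        α * v k + β * w k := fun k => (congrFun hαβ k).symm
    calc _ = α * ∑ k, l k * v k + β * ∑ k, l k * w k := by
          rw [Finset.mul_sum, Finset.mul_sum, ← Finset.sum_add_distrib]
          exact Finset.sum_congr rfl fun k _ => by rw [this]; ring
      _ = 0 := by rw [hlv, hlw]; simp
  -- A translate of a member of the family is again a member, so the plane is stable under the Klein
  -- group and also contains the translates of `q ∘ σ`.
  have hann : ∀ (g : ZMod 2 × ZMod 2) (l : Fin 4 → K), ∑ k, l k * v k = 0 → ∑ k, l k * w k = 0 →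
      ∑ k, l k • q (σ (indexTranslate kleinEquiv g k)) = 0 := by
    intro g l hlv hlw
    rw [← hσ (fun k => l ((indexTranslate kleinEquiv g).symm k)) ?_ ?_]
    · exact Fintype.sum_equiv (indexTranslate kleinEquiv g) _ _ fun k => by simp
    · rw [← Equiv.sum_comp (indexTranslate kleinEquiv g), ← hinv u₁ g l hlv hlw, hv]
      simp
    · rw [← Equiv.sum_comp (indexTranslate kleinEquiv g), ← hinv u₂ g l hlv hlw, hw]
      simp
  obtain ⟨g₁, hg₁⟩ := exists_indexTranslate_kleinEquiv_conj σ (0, 1)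
  obtain ⟨g₂, hg₂⟩ := exists_indexTranslate_kleinEquiv_conj σ (1, 0)
  have hq2 : ∀ k, q (indexTranslate kleinEquiv (1, 0) k) = - q k := by
    intro k
    fin_cases k
    · change q 2 = - q 0; simp [hqdef]
    · change q 3 = - q 1; simp [hqdef]
    · change q 0 = - q 2; simp [hqdef]
    · change q 1 = - q 3; simp [hqdef]
  -- The spectrum `q` and its translate by `(0, 1)` are independent, because `ε² = -1` differs from
  -- 1. Both are negated by `(1, 0)`. Normality transports this through `σ`.
  refine ⟨indexTranslate kleinEquiv g₂, comp_eq_neg_of_linearIndependent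
    (exists_eq_smul_add_smul_of_forall_sum_eq_zero hvw (d := fun k => q (σ k)) hσ)
    (exists_eq_smul_add_smul_of_forall_sum_eq_zero hvw (hann g₁)) ?_ ?_ ?_⟩
  · rw [LinearIndependent.pair_iff]
    intro s t hst
    have e0 := congrFun hst (σ.symm 0)
    have e1 := congrFun hst (σ.symm 1)
    simp only [Pi.add_apply, Pi.smul_apply, hg₁, Equiv.apply_symm_apply, Pi.zero_apply,
      smul_eq_mul] at e0 e1
    change s * q 0 + t * q 1 = 0 at e0
    change s * q 1 + t * q 0 = 0 at e1
    simp only [hqdef, Matrix.cons_val] at e0 e1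
    have h2' : (2 : AlgebraicClosure K) ≠ 0 := by
      have := (map_ne_zero (algebraMap K (AlgebraicClosure K))).mpr h2
      rwa [map_ofNat] at this
    have ht : 2 * (t * r) = 0 := by linear_combination e1 - ε * e0 + t * r * hε
    have hs : 2 * (s * r) = 0 := by linear_combination e0 - ε * e1 + s * r * hε
    simpa [h2', hr] using And.intro hs ht
  · intro k
    rw [hg₂, hq2]
  · intro k
    rw [← indexTranslate_add, add_comm, indexTranslate_add, hg₂, hq2]

/-- A noncentral multilinear polynomial has a spectral plane. -/
theorem IsMultilinearPoly.exists_isSpectralPlane (hp : IsMultilinearPoly p)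
    (hPI : ¬ IsPIOf p (Matrix (Fin 4) (Fin 4) K))
    (hcentral : ¬ IsCentralPolyOf p (Matrix (Fin 4) (Fin 4) K)) (h2 : (2 : K) ≠ 0) :
    ∃ v w : Fin 4 → K, IsSpectralPlane p v w := by
  obtain ⟨i, j, -, a, b, hab⟩ := hp.exists_single_isDiag hPI hcentral
  set D : Fin 4 → K := fun k => (ncEval p fun k => Matrix.single (i k) (j k) (1 : K)) k k with hD
  change D a ≠ D b at hab
  by_cases hind : ∃ h, LinearIndependent K ![D, fun k => D (indexTranslate kleinEquiv h k)]
  · obtain ⟨h, hind⟩ := hind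
    exact hp.isSpectralPlane_of_klein hPI hcentral h2 (fun _ => rfl) hind
  -- Now `D` is a common eigenvector of the generators of the Klein group, which are involutions, so
  -- the eigenvalues are `±1`.
  push Not at hind
  have hD0 : D ≠ 0 := by
    rintro h0
    simp [h0] at hab
  have h1 := hind (0, 1)
  have h3 := hind (1, 0)
  rw [LinearIndependent.pair_iff' hD0] at h1 h3
  push Not at h1 h3
  obtain ⟨c, hc⟩ := h1
  obtain ⟨c', hc'⟩ := h3
  have e0 : c * D 0 = D 1 := congrFun hc 0
  have e1 : c * D 1 = D 0 := congrFun hc 1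
  have e2 : c' * D 0 = D 2 := congrFun hc' 0
  have e3 : c' * D 1 = D 3 := congrFun hc' 1
  have e4 : c' * D 2 = D 0 := congrFun hc' 2
  have hx : D 0 ≠ 0 := by
    intro h0
    apply hD0
    ext k
    have h5 : D 1 = 0 := by rw [← e0, h0, mul_zero]
    fin_cases k
    · exact h0
    · exact h5
    · change D 2 = 0
      rw [← e2, h0, mul_zero]
    · change D 3 = 0
      rw [← e3, h5, mul_zero]
  have hcc : c = 1 ∨ c = -1 := by
    rw [← mul_self_eq_one_iff]
    apply mul_right_cancel₀ hx
    linear_combination c * e0 + e1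
  have hcc' : c' = 1 ∨ c' = -1 := by
    rw [← mul_self_eq_one_iff]
    apply mul_right_cancel₀ hx
    linear_combination c' * e2 + e4
  have key : ∀ τ : Fin 4 ≃ ZMod 4,
      (D (τ.symm 0) = D 0 ∧ D (τ.symm 1) = D 0 ∧ D (τ.symm 2) = - D 0 ∧ D (τ.symm 3) = - D 0) →
      ∃ v w : Fin 4 → K, IsSpectralPlane p v w := by
    rintro τ ⟨h0, h1, h2', h3⟩
    refine hp.isSpectralPlane_of_cyclic (i := i) (j := j) h2 hx τ fun g => ?_
    change D (τ.symm g) = _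
    fin_cases g
    · exact h0
    · exact h1
    · exact h2'
    · exact h3
  -- Both signs `+1` would make `D` constant. In each other case the 4-cycle is labelled so that
  -- equal entries are adjacent.
  rcases hcc with rfl | rfl <;> rcases hcc' with rfl | rfl
  · exfalso
    apply hab
    have : ∀ k, D k = D 0 := by
      intro k
      fin_cases k
      · rfl
      · exact (one_mul (D 1)).symm.trans e1
      · exact (one_mul (D 2)).symm.trans e4
      · change D 3 = D 0
        rw [← e3, one_mul, ← e0, one_mul]
    rw [this a, this b]
  · refine key (Equiv.refl _) ⟨rfl, ?_, ?_, ?_⟩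
    · change D 1 = D 0
      linear_combination e1
    · change D 2 = - D 0
      linear_combination -e2
    · change D 3 = - D 0
      linear_combination -e3 - e1
  · refine key (Equiv.swap (1 : Fin 4) 2) ⟨?_, ?_, ?_, ?_⟩
    · change D 0 = D 0
      rfl
    · change D 2 = D 0
      linear_combination -e2
    · change D 1 = - D 0
      linear_combination -e0
    · change D 3 = - D 0
      linear_combination -e3 - e0
  · refine key (Equiv.swap (1 : Fin 4) 3) ⟨?_, ?_, ?_, ?_⟩
    · change D 0 = D 0
      rfl
    · change D 3 = D 0
      linear_combination -e3 + e0
    · change D 2 = - D 0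
      linear_combination -e2
    · change D 1 = - D 0
      linear_combination -e0

end Cases

/-! ### From the plane to eigenvalues of values -/

section Conclusion

variable {K : Type*} [Field K] [Infinite K] {m : ℕ} {p : FreeAlgebra K (Fin m)}
  {i j : Fin m → Fin 4}

/-- Relations of the generic value specialize to the pencil, so independence on the pencil lifts
back. -/
theorem IsSpectralPlane.exists_algebraicIndependent {v w : Fin 4 → K} (h : IsSpectralPlane p v w) :
    ∃ f : Fin 2 → MvPolynomial (Fin 4) K, AlgebraicIndependent K fun t =>
      MvPolynomial.aeval (charInvariants (genericValue p)) (f t) := by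
  obtain ⟨f, hf⟩ := exists_algebraicIndependent_pencil h.1
  refine ⟨f, algebraicIndependent_iff.mpr fun H hH => ?_⟩
  rw [← MvPolynomial.comp_aeval_apply] at hH
  have := h.2.1 _ hH
  rw [MvPolynomial.comp_aeval_apply] at this
  exact algebraicIndependent_iff.mp hf H this

/-- Indices 0 and 2 carry `e₁` and `e₃`, which vanish on the antisymmetric plane. Without three
independent invariants, these two relations pass to the generic value. -/
theorem IsSpectralPlane.charInvariants_genericValue {v w : Fin 4 → K} (h : IsSpectralPlane p v w)
    (h2 : (2 : K) ≠ 0) (h3 : ∀ f : Option (Fin 2) → MvPolynomial (Fin 4) K,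
      ¬ AlgebraicIndependent K fun t =>
        MvPolynomial.aeval (charInvariants (genericValue p)) (f t)) :
    charInvariants (genericValue p) 0 = 0 ∧ charInvariants (genericValue p) 2 = 0 := by
  obtain ⟨hker, ρ, hv, hw⟩ := h.2.2 h3
  have h2' : (2 : MvPolynomial (Fin 2) K) ≠ 0 := by
    have := (map_ne_zero_iff _ (MvPolynomial.C_injective (Fin 2) K)).mpr h2
    rwa [map_ofNat] at this
  obtain ⟨h0, h2⟩ := charInvariants_eq_zero_of_comp_eq_neg h2' (z := genericPencil v w) (ρ := ρ)
    fun k => by simp only [genericPencil, hv, hw, neg_smul]; ring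
  constructor
  · simpa using hker (MvPolynomial.X 0) (by simpa using h0)
  · simpa using hker (MvPolynomial.X 2) (by simpa using h2)

theorem charInvariants_ncEval_eq_zero {L : Type*} [CommRing L] [Algebra K L] {k : Fin 4}
    (h : charInvariants (genericValue p) k = 0) (a : Fin m → Matrix (Fin 4) (Fin 4) L) :
    charInvariants (ncEval p a) k = 0 := by
  simpa using aeval_charInvariants_ncEval (F := MvPolynomial.X k) (by simpa using h) a

theorem roots_prod_four {R : Type*} [CommRing R] [IsDomain R] (a b c d : R) :
    ((Polynomial.X - Polynomial.C a) * (Polynomial.X - Polynomial.C b) *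
      (Polynomial.X - Polynomial.C c) * (Polynomial.X - Polynomial.C d)).roots = {a, b, c, d} := by
  have := Polynomial.roots_multiset_prod_X_sub_C ({a, b, c, d} : Multiset R)
  rw [← this]
  simp [mul_assoc]

/-- The characteristic polynomial is even, `X⁴ + aX² + b`, and `l₁`, `l₂` are square roots of the
two roots of the quadratic in `X²`. -/
theorem exists_aroots_charpoly_eq {M : Matrix (Fin 4) (Fin 4) K} (h0 : charInvariants M 0 = 0)
    (h2 : charInvariants M 2 = 0) : ∃ l₁ l₂ : AlgebraicClosure K,
      M.charpoly.aroots (AlgebraicClosure K) = {l₁, l₂, -l₁, -l₂} := by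
  have h3 : M.charpoly.coeff 3 = 0 := by
    have : charInvariants M 0 = (-1) ^ 1 * M.charpoly.coeff 3 := rfl
    simpa [this] using h0
  have h1 : M.charpoly.coeff 1 = 0 := by
    have : charInvariants M 2 = (-1) ^ 3 * M.charpoly.coeff 1 := rfl
    rw [this] at h2
    simpa using h2
  have hdeg : M.charpoly.natDegree = 4 := by simp
  have h4 : M.charpoly.coeff 4 = 1 := by
    have := (Matrix.charpoly_monic M).coeff_natDegree
    rwa [hdeg] at this
  set a := algebraMap K (AlgebraicClosure K) (M.charpoly.coeff 2)
  set b := algebraMap K (AlgebraicClosure K) (M.charpoly.coeff 0)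
  have hpoly : M.charpoly.map (algebraMap K (AlgebraicClosure K)) =
      Polynomial.X ^ 4 + Polynomial.C a * Polynomial.X ^ 2 + Polynomial.C b := by
    rw [M.charpoly.as_sum_range_C_mul_X_pow, hdeg]
    simp only [Finset.sum_range_succ, h1, h3, h4, a, b]
    simp
    ring
  obtain ⟨μ, hμ⟩ := IsAlgClosed.exists_root
    (Polynomial.X ^ 2 + Polynomial.C a * Polynomial.X + Polynomial.C b) (by
      have : (Polynomial.X ^ 2 + Polynomial.C a * Polynomial.X + Polynomial.C b).degree = 2 := by
        compute_degree!
      rw [this]; decide)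
  obtain ⟨l₁, hl₁⟩ := IsAlgClosed.exists_pow_nat_eq μ (n := 2) (by norm_num)
  obtain ⟨l₂, hl₂⟩ := IsAlgClosed.exists_pow_nat_eq (-a - μ) (n := 2) (by norm_num)
  refine ⟨l₁, l₂, ?_⟩
  rw [Polynomial.aroots_def, hpoly, ← roots_prod_four]
  congr 1
  simp only [Polynomial.IsRoot.def, Polynomial.eval_add, Polynomial.eval_mul, Polynomial.eval_pow,
    Polynomial.eval_X, Polynomial.eval_C] at hμ
  have ha : Polynomial.C a = - Polynomial.C l₁ ^ 2 - Polynomial.C l₂ ^ 2 := by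
    rw [← map_pow, ← map_pow, hl₁, hl₂, map_sub, map_neg]; ring
  have hb : Polynomial.C b = Polynomial.C l₁ ^ 2 * Polynomial.C l₂ ^ 2 := by
    rw [← map_pow, ← map_pow, hl₁, hl₂, ← map_mul]
    congr 1
    linear_combination hμ
  rw [ha, hb, map_neg, map_neg]
  ring

/-- If the spectra of all values of `p` are antisymmetric, then so is every diagonal value on
matrix units under some translation along a given 4-cycle. -/
theorem IsMultilinearPoly.exists_add_translate_eq_zero (hp : IsMultilinearPoly p)
    (h0 : charInvariants (genericValue p) 0 = 0) (h2 : charInvariants (genericValue p) 2 = 0)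
    {D : Fin 4 → K} (hD : ∀ k, (ncEval p fun k => Matrix.single (i k) (j k) (1 : K)) k k = D k)
    {x : Fin 4} (hx : D x ≠ 0) (φ : Fin 4 ≃ ZMod 4) :
    ∃ h : ZMod 4, h ≠ 0 ∧ ∀ g, D (φ.symm g) + D (φ.symm (g + h)) = 0 := by
  have hd := hp.sum_sub_eq_zero (x := x) (by rw [hD]; exact hx) φ
  set y : ZMod 4 → MvPolynomial (Fin m × ZMod 4) K := fun g =>
    genericTranslateValue p φ i j (φ.symm g) (φ.symm g) with hy
  have hgen : genericTranslateValue p φ i j =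
      Matrix.diagonal fun k => genericTranslateValue p φ i j k k :=
    hp.translateValue_eq_diagonal hd _
  let ρ : Equiv.Perm (Fin 4) := φ.symm
  have hinv : ∀ k, charInvariants (genericValue p) k = 0 → charInvariants
      (Matrix.diagonal fun t => genericTranslateValue p φ i j (ρ t) (ρ t)) k = 0 := by
    intro k hk
    have h3 := charInvariants_ncEval_eq_zero hk fun k => translateComb φ (i k) (j k)
      fun g => MvPolynomial.X (R := K) (k, g)
    change charInvariants (genericTranslateValue p φ i j) k = 0 at h3
    rw [hgen, ← charInvariants_submatrix _ ρ, Matrix.submatrix_diagonal_equiv] at h3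
    exact h3
  have e0 := hinv 0 h0
  have e2 := hinv 2 h2
  rw [charInvariants_diagonal_zero] at e0
  rw [charInvariants_diagonal_two] at e2
  change y 0 + y 1 + y 2 + y 3 = 0 at e0
  change y 0 * y 1 * y 2 + y 0 * y 1 * y 3 + y 0 * y 2 * y 3 + y 1 * y 2 * y 3 = 0 at e2
  -- The product equals `y₀² e₁ + e₃`, and in a domain one factor must vanish.
  have hprod : (y 0 + y 1) * (y 0 + y 2) * (y 0 + y 3) = 0 := by
    linear_combination y 0 ^ 2 * e0 + e2
  have htrans : ∀ g : ZMod 4, MvPolynomial.aeval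
      (fun kg : Fin m × ZMod 4 => MvPolynomial.X (R := K) (kg.1, kg.2 + g)) (y 0) = y g ∧
      ∀ h, MvPolynomial.aeval
        (fun kg : Fin m × ZMod 4 => MvPolynomial.X (R := K) (kg.1, kg.2 + g)) (y h) = y (g + h) := by
    have : ∀ g h : ZMod 4, MvPolynomial.aeval
        (fun kg : Fin m × ZMod 4 => MvPolynomial.X (R := K) (kg.1, kg.2 + g)) (y h) = y (g + h) := by
      intro g h
      have h1 := genericTranslateValue_translate (p := p) (φ := φ) (i := i) (j := j) (-g)
        (φ.symm (g + h)) (φ.symm (g + h))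
      have h3 : indexTranslate φ (-g) (φ.symm (g + h)) = φ.symm h := by
        rw [Equiv.eq_symm_apply, apply_indexTranslate, Equiv.apply_symm_apply]
        abel
      simp only [h3, sub_neg_eq_add] at h1
      exact h1
    exact fun g => ⟨by rw [this, add_zero], this g⟩
  have hev : ∀ g, MvPolynomial.aeval (fun kg : Fin m × ZMod 4 =>
      (Pi.single 0 1 : ZMod 4 → K) kg.2) (y g) = D (φ.symm g) := by
    intro g
    rw [hy, aeval_genericTranslateValue fun _ => (Pi.single 0 1 : ZMod 4 → K),
      translateValue_pi_single, hD]
  -- Translating the variables spreads the identity around the cycle before it is specialized to the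
  -- matrix units.
  have key : ∀ h, y 0 + y h = 0 → ∀ g, D (φ.symm g) + D (φ.symm (g + h)) = 0 := by
    intro h hh g
    have h1 := congrArg (MvPolynomial.aeval
      (fun kg : Fin m × ZMod 4 => MvPolynomial.X (R := K) (kg.1, kg.2 + g))) hh
    rw [map_add, (htrans g).1, (htrans g).2, map_zero] at h1
    rw [← hev, ← hev, ← map_add, h1, map_zero]
  rcases mul_eq_zero.mp hprod with h | h
  · rcases mul_eq_zero.mp h with h | h
    · exact ⟨1, by decide, key 1 h⟩
    · exact ⟨2, by decide, key 2 h⟩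
  · exact ⟨3, by decide, key 3 h⟩

/-- Along one 4-cycle the entries either alternate in sign, which suffices, or opposite entries are
negatives of each other. The three 4-cycles used have the three different pairings as opposites; if
all three pairings negate, then `2 * D 0 = 0` and `D` vanishes. -/
theorem IsMultilinearPoly.exists_roots_charpoly_eq (hp : IsMultilinearPoly p) (hK : (2 : K) ≠ 0)
    (h0 : charInvariants (genericValue p) 0 = 0) (h2 : charInvariants (genericValue p) 2 = 0)
    (hdiag : (ncEval p fun k => Matrix.single (i k) (j k) (1 : K)).IsDiag) :
    ∃ c : K, (ncEval p fun k => Matrix.single (i k) (j k) (1 : K)).charpoly.roots =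
      {c, c, -c, -c} := by
  set M := ncEval p fun k => Matrix.single (i k) (j k) (1 : K) with hM
  set D : Fin 4 → K := fun k => M k k with hD
  have hMD : M.charpoly = (Polynomial.X - Polynomial.C (D 0)) * (Polynomial.X - Polynomial.C (D 1)) *
      (Polynomial.X - Polynomial.C (D 2)) * (Polynomial.X - Polynomial.C (D 3)) := by
    have : M = Matrix.diagonal D := hdiag.diagonal_diag.symm
    rw [this, Matrix.charpoly_diagonal, Fin.prod_univ_four]
  by_cases hD0 : D = 0
  · refine ⟨0, ?_⟩
    rw [hMD, hD0, roots_prod_four]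
    simp
  obtain ⟨x, hx⟩ := Function.ne_iff.mp hD0
  have hcyc := hp.exists_add_translate_eq_zero (i := i) (j := j) h0 h2 (D := D) (fun _ => rfl) hx
  have hsplit : ∀ φ : Fin 4 ≃ ZMod 4,
      (D (φ.symm 1) = - D (φ.symm 0) ∧ D (φ.symm 2) = D (φ.symm 0) ∧
        D (φ.symm 3) = - D (φ.symm 0)) ∨
      (D (φ.symm 2) = - D (φ.symm 0) ∧ D (φ.symm 3) = - D (φ.symm 1)) := by
    intro φ
    obtain ⟨h, hh, hg⟩ := hcyc φ
    have g0 := hg 0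
    have g1 := hg 1
    have g2 := hg 2
    have g3 := hg 3
    fin_cases h
    · exact absurd rfl hh
    · change D (φ.symm 0) + D (φ.symm 1) = 0 at g0
      change D (φ.symm 1) + D (φ.symm 2) = 0 at g1
      change D (φ.symm 2) + D (φ.symm 3) = 0 at g2
      exact .inl ⟨by linear_combination g0, by linear_combination g1 - g0,
        by linear_combination g2 - g1 + g0⟩
    · change D (φ.symm 0) + D (φ.symm 2) = 0 at g0
      change D (φ.symm 1) + D (φ.symm 3) = 0 at g1
      exact .inr ⟨by linear_combination g0, by linear_combination g1⟩
    · change D (φ.symm 0) + D (φ.symm 3) = 0 at g0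
      change D (φ.symm 1) + D (φ.symm 0) = 0 at g1
      change D (φ.symm 2) + D (φ.symm 1) = 0 at g2
      exact .inl ⟨by linear_combination g1, by linear_combination g2 - g1,
        by linear_combination g0⟩
  have hfin : ∀ c, M.charpoly = (Polynomial.X - Polynomial.C c) * (Polynomial.X - Polynomial.C c) *
      (Polynomial.X - Polynomial.C (-c)) * (Polynomial.X - Polynomial.C (-c)) →
      ∃ c : K, M.charpoly.roots = {c, c, -c, -c} :=
    fun c hc => ⟨c, by rw [hc, roots_prod_four]⟩
  rcases hsplit (Equiv.refl (Fin 4)) with ⟨a1, a2, a3⟩ | ⟨a1, a2⟩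
  · change D 1 = - D 0 at a1
    change D 2 = D 0 at a2
    change D 3 = - D 0 at a3
    refine hfin (D 0) ?_
    rw [hMD, a1, a2, a3]
    ring
  rcases hsplit (Equiv.swap (1 : Fin 4) 2) with ⟨b1, b2, b3⟩ | ⟨b1, b2⟩
  · change D 2 = - D 0 at b1
    change D 1 = D 0 at b2
    change D 3 = - D 0 at b3
    refine hfin (D 0) ?_
    rw [hMD, b1, b2, b3]
  rcases hsplit (Equiv.swap (2 : Fin 4) 3) with ⟨c1, c2, c3⟩ | ⟨c1, c2⟩
  · change D 1 = - D 0 at c1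
    change D 3 = D 0 at c2
    change D 2 = - D 0 at c3
    refine hfin (D 0) ?_
    rw [hMD, c1, c2, c3]
    ring
  exfalso
  change D 2 = - D 0 at a1
  change D 3 = - D 1 at a2
  change D 1 = - D 0 at b1
  change D 3 = - D 0 at c1
  have hz : D 0 = 0 := by
    refine (mul_eq_zero.mp (?_ : (2 : K) * D 0 = 0)).resolve_left hK
    linear_combination c1 - a2 + b1
  apply hD0
  ext k
  fin_cases k
  · exact hz
  · change D 1 = 0
    rw [b1, hz, neg_zero]
  · change D 2 = 0
    rw [a1, hz, neg_zero]
  · change D 3 = 0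
    rw [c1, hz, neg_zero]

end Conclusion

/-! ### The main theorem -/

theorem mainTheorem10 {K : Type*} [Field K] [Infinite K] (hK : ringChar K ≠ 2)
    {m : ℕ} (p : FreeAlgebra K (Fin m)) (hp : IsMultilinearPoly p)
    (hPI : ¬ IsPIOf p (Matrix (Fin 4) (Fin 4) K))
    (hcentral : ¬ IsCentralPolyOf p (Matrix (Fin 4) (Fin 4) K)) :
    14 ≤ zariskiDim (imageOf p (Matrix (Fin 4) (Fin 4) K)) ∧
    (zariskiDim (imageOf p (Matrix (Fin 4) (Fin 4) K)) = 14 →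
      (∀ i j : Fin m → Fin 4,
        (ncEval p fun k => Matrix.single (i k) (j k) (1 : K)).IsDiag →
        ∃ c : K,
          (ncEval p fun k => Matrix.single (i k) (j k) (1 : K)).charpoly.roots
            = {c, c, -c, -c}) ∧
      (∀ M ∈ imageOf p (Matrix (Fin 4) (Fin 4) K),
        ∃ l₁ l₂ : AlgebraicClosure K,
          M.charpoly.aroots (AlgebraicClosure K) = {l₁, l₂, -l₁, -l₂})) := by
  have h2 : (2 : K) ≠ 0 := Ring.two_ne_zero hK
  obtain ⟨v, w, hvw⟩ := hp.exists_isSpectralPlane hPI hcentral h2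
  obtain ⟨f, hf⟩ := hvw.exists_algebraicIndependent
  refine ⟨hp.add_card_le_zariskiDim hPI hcentral hf, fun h14 => ?_⟩
  -- Three independent functions of the spectrum would give dimension at least 15.
  obtain ⟨e0, e2⟩ := hvw.charInvariants_genericValue h2 fun f hf => by
    have h15 := hp.add_card_le_zariskiDim hPI hcentral hf
    rw [h14] at h15
    simp only [Fintype.card_option, Fintype.card_fin] at h15
    exact absurd h15 (by norm_cast)
  refine ⟨fun i j hdiag => hp.exists_roots_charpoly_eq h2 e0 e2 hdiag, ?_⟩
  rintro _ ⟨a, rfl⟩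
  exact exists_aroots_charpoly_eq (charInvariants_ncEval_eq_zero e0 a)
    (charInvariants_ncEval_eq_zero e2 a)
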